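/- For a number field $K$ with set of places $M_K$ and $v\in M_K$, let $\|\cdot\|_v$ be the absolute value on $K$ that extends the usual archimedean or $\ell$-adic absolute value of $\mathbb{Q}$. For $\alpha\in K^\times$ put $$h_p(\alpha)=\Big(\sum_{v\in M_K}\tfrac{[K_v:\mathbb{Q}_v]}{[K:\mathbb{Q}]}\,\big|\log\|\alpha\|_v\big|^p\Big)^{1/p}\ (1\le p<\infty),\qquad h_\infty(\alpha)=\sup_{v\in M_K}\big|\log\|\alpha\|_v\big|,$$ and let $h(\alpha)=\sum_{v}\tfrac{[K_v:\mathbb{Q}_v]}{[K:\mathbb{Q}]}\log^+\|\alpha\|_v$ be the absolute logarithmic Weil height; none of these depends on the choice of $K\ni\alpha$. For $\alpha\in\overline{\mathbb{Q}}^\times$ put $m_p(\alpha)=(\deg\alpha)\,h_p(\alpha)$. Let $\mathcal{G}=\overline{\mathbb{Q}}^\times/\operatorname{Tor}(\overline{\mathbb{Q}}^\times)$, a $\mathbb{Q}$-vector space written multiplicatively. For $\boldsymbol{\alpha}\in\mathcal{G}$ let $d(\boldsymbol{\alpha})$ be the least degree of a representative, let $h_p(\boldsymbol{\alpha})$ be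 the common value of $h_p$ at all representatives, put $m_p(\boldsymbol{\alpha})=d(\boldsymbol{\alpha})h_p(\boldsymbol{\alpha})$, and define the extremal norm $$\widetilde m_p(\boldsymbol{\alpha})=\inf\Big\{\sum_{i=1}^n|r_i|\,m_p(\boldsymbol{\alpha}_i)\;:\;\boldsymbol{\alpha}=\boldsymbol{\alpha}_1^{r_1}\cdots\boldsymbol{\alpha}_n^{r_n},\ \boldsymbol{\alpha}_i\in\mathcal{G},\ r_i\in\mathbb{Q}\Big\}.$$ Let $\mathcal{A}\subset\mathcal{G}$ be the set of $\boldsymbol{\alpha}\ne\boldsymbol{1}$ that have a representative $\alpha$ such that (i) $\alpha$ is an algebraic unit, (ii) $[\mathbb{Q}(\alpha^n):\mathbb{Q}]=[\mathbb{Q}(\alpha):\mathbb{Q}]$ for all integers $n\ge1$, and (iii) for every proper subfield $F$ of $K=\mathbb{Q}(\alpha)$, the norm $\operatorname{Norm}^K_F(\alpha)$ is a root of unity. Theorem. Let $1\le p\le\infty$. If there is a constant $c_p$ such that $\widetilde m_p(\boldsymbol{\alpha})\ge c_p>0$ for all $\boldsymbol{\alpha}\in\mathcal{A}$, then there is a constant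 $c_p'$ such that $m_p(\alpha)\ge c_p'>0$ for all $\alpha\in\overline{\mathbb{Q}}^\times\setminus\operatorname{Tor}(\overline{\mathbb{Q}}^\times)$. In particular, the hypothesis for $p=1$ implies Lehmer's conjecture: there is $c>0$ such that $(\deg\alpha)\,h(\alpha)\ge c$ for all $\alpha\in\overline{\mathbb{Q}}^\times\setminus\operatorname{Tor}(\overline{\mathbb{Q}}^\times)$. The hypothesis for $p=\infty$ implies the Schinzel–Zassenhaus conjecture: there is $c>0$ such that every algebraic integer $\alpha\ne0$ that is not a root of unity has a conjugate in $\mathbb{C}$ of absolute value at least $1+c/\deg\alpha$. -/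

import Mathlib

open scoped ENNReal IntermediateField

noncomputable section

namespace ExtremalNorm

/-! ## Places of a number field, and heights -/

section Heights

variable (K : Type*) [Field K] [NumberField K]

/-- The set `M_K` of places of the number field `K`. -/
abbrev Place : Type _ := NumberField.InfinitePlace K ⊕ NumberField.FinitePlace K

variable {K}

/-- The local degree `[K_v : ℚ_v]`: it is `1` or `2` for a real or complex place, and the product
`e * f` of the ramification index and the inertia degree (over `ℤ`) for a finite place. -/
def Place.localDegree : Place K → ℕ
  | Sum.inl v => v.mult
  | Sum.inr v => v.maximalIdeal.asIdeal.ramificationIdx ℤ * v.maximalIdeal.asIdeal.inertiaDeg ℤ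

/-- The absolute value `‖x‖_v` that extends the usual archimedean or `p`-adic absolute value
of `ℚ`. Mathlib normalizes the absolute value of a finite place `v` by `|x|_v = N(v) ^ (-ord_v x)`,
which is the `[K_v : ℚ_v]`-th power of the one that extends the `p`-adic one. -/
def Place.abv : Place K → K → ℝ
  | Sum.inl v, x => v x
  | Sum.inr v, x => (v x) ^ ((Place.localDegree (Sum.inr v) : ℝ)⁻¹)

/-- The `L^p` Weil height of `x ∈ K`, computed in the number field `K`:
`(∑_v [K_v : ℚ_v] / [K : ℚ] * |log ‖x‖_v| ^ p) ^ (1 / p)` for `p < ∞`, and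
`sup_v |log ‖x‖_v|` for `p = ∞`. For `x ≠ 0` only finitely many terms are nonzero. -/
def heightIn (p : ℝ≥0∞) (x : K) : ℝ :=
  if p = ∞ then ⨆ v : Place K, |Real.log (v.abv x)|
  else (∑ᶠ v : Place K, (v.localDegree : ℝ) / (Module.finrank ℚ K : ℝ) *
      |Real.log (v.abv x)| ^ p.toReal) ^ (p.toReal)⁻¹

/-- The absolute logarithmic Weil height of `x ∈ K`, computed in the number field `K`:
`∑_v [K_v : ℚ_v] / [K : ℚ] * log⁺ ‖x‖_v`. -/
def weilHeightIn (x : K) : ℝ :=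
  ∑ᶠ v : Place K, (v.localDegree : ℝ) / (Module.finrank ℚ K : ℝ) * Real.posLog (v.abv x)

end Heights

/-- The field of algebraic numbers. -/
abbrev Qbar : Type := AlgebraicClosure ℚ

instance : Algebra.IsAlgebraic ℚ Qbar := AlgebraicClosure.isAlgebraic ℚ

instance numberFieldAdjoin (α : Qbar) : NumberField ℚ⟮α⟯ where
  to_charZero := inferInstance
  to_finiteDimensional :=
    IntermediateField.adjoin.finiteDimensional (Algebra.IsIntegral.isIntegral α)

/-- `deg α = [ℚ(α) : ℚ]`. -/
def deg (α : Qbar) : ℕ := Module.finrank ℚ ℚ⟮α⟯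

/-- The `L^p` Weil height `h_p(α)`. It does not depend on the number field containing `α` in which
it is computed; here that field is `ℚ(α)`. -/
def height (p : ℝ≥0∞) (α : Qbarˣ) : ℝ :=
  heightIn p (IntermediateField.AdjoinSimple.gen ℚ (α : Qbar))

/-- The absolute logarithmic Weil height `h(α)`. -/
def weilHeight (α : Qbarˣ) : ℝ :=
  weilHeightIn (IntermediateField.AdjoinSimple.gen ℚ (α : Qbar))

/-- The `L^p` Mahler measure `m_p(α) = (deg α) * h_p(α)`. -/
def mahler (p : ℝ≥0∞) (α : Qbarˣ) : ℝ := (deg (α : Qbar) : ℝ) * height p α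

/-- The house of `α`: the largest modulus of a conjugate of `α` in `ℂ`. -/
def house (α : Qbar) : ℝ := NumberField.house (IntermediateField.AdjoinSimple.gen ℚ α)

/-! ## Algebraic numbers modulo torsion -/

/-- The group `𝒢` of nonzero algebraic numbers modulo roots of unity, written additively. -/
abbrev AlgModTors : Type := Additive (Qbarˣ ⧸ CommGroup.torsion Qbarˣ)

/-- The class of `α` modulo torsion. -/
def cls (α : Qbarˣ) : AlgModTors := Additive.ofMul (QuotientGroup.mk α)

theorem exists_nsmul_eq (n : ℕ) (hn : n ≠ 0) (a : AlgModTors) : ∃ b : AlgModTors, n • b = a := by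
  obtain ⟨α, hα⟩ := QuotientGroup.mk_surjective (Additive.toMul a)
  obtain ⟨z, hz⟩ := IsAlgClosed.exists_pow_nat_eq (α : Qbar) (Nat.pos_of_ne_zero hn)
  have hz0 : z ≠ 0 := by
    rintro rfl
    rw [zero_pow hn] at hz
    exact α.ne_zero hz.symm
  refine ⟨cls (Units.mk0 z hz0), ?_⟩
  have h : (Units.mk0 z hz0) ^ n = α := Units.ext (by simpa using hz)
  calc n • cls (Units.mk0 z hz0) = cls ((Units.mk0 z hz0) ^ n) := rfl
    _ = a := by rw [h]; exact congrArg Additive.ofMul hα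

/-- The unique `b` with `n b = a`, for `n ≠ 0` (that is, the `n`-th root of the class `a`). -/
def divNat (a : AlgModTors) (n : ℕ) : AlgModTors :=
  if hn : n = 0 then 0 else (exists_nsmul_eq n hn a).choose

theorem nsmul_divNat (a : AlgModTors) {n : ℕ} (hn : n ≠ 0) : n • divNat a n = a := by
  rw [divNat, dif_neg hn]
  exact (exists_nsmul_eq n hn a).choose_spec

theorem nsmul_inj {n : ℕ} (hn : n ≠ 0) {a b : AlgModTors} (h : n • a = n • b) : a = b :=
  nsmul_right_injective hn h

/-- Multiplication by a rational number on `𝒢`; multiplicatively, `a ↦ a ^ r`. -/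
instance : SMul ℚ AlgModTors := ⟨fun r a => divNat (r.num • a) r.den⟩

theorem den_nsmul_smul (r : ℚ) (a : AlgModTors) : r.den • (r • a) = r.num • a :=
  nsmul_divNat _ r.den_ne_zero

theorem smul_eq_of {r : ℚ} {a b : AlgModTors} {n : ℕ} {m : ℤ} (hn : n ≠ 0) (hr : r * n = m)
    (h : n • b = m • a) : r • a = b := by
  have h1 : r.num * (n : ℤ) = m * (r.den : ℤ) := by
    have h2 : (r.num : ℚ) = r * r.den := (Rat.mul_den_eq_num r).symm
    have : (r.num : ℚ) * n = m * r.den := by rw [h2, ← hr]; ring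
    exact_mod_cast this
  apply nsmul_inj (mul_ne_zero hn r.den_ne_zero)
  calc (n * r.den) • (r • a) = (r.num * (n : ℤ)) • a := by
        rw [mul_nsmul', den_nsmul_smul, mul_comm r.num, mul_zsmul, natCast_zsmul]
    _ = (n * r.den) • b := by
        rw [h1, mul_comm n, mul_nsmul', h, mul_comm m, mul_zsmul, natCast_zsmul]

/-- The `ℚ`-vector space structure on `𝒢`. -/
instance : Module ℚ AlgModTors where
  one_smul a := smul_eq_of one_ne_zero (n := 1) (m := 1) (by simp) (by simp)
  mul_smul r s a := by
    refine smul_eq_of (n := r.den * s.den) (m := r.num * s.num)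
      (mul_ne_zero r.den_ne_zero s.den_ne_zero) ?_ ?_
    · push_cast
      rw [← Rat.mul_den_eq_num r, ← Rat.mul_den_eq_num s]; ring
    · rw [mul_comm r.den, mul_nsmul', den_nsmul_smul, mul_zsmul, ← natCast_zsmul,
        ← mul_zsmul, mul_comm _ r.num, mul_zsmul, natCast_zsmul, den_nsmul_smul]
  smul_zero r := smul_eq_of (n := r.den) (m := r.num) r.den_ne_zero (Rat.mul_den_eq_num r)
    (by simp)
  zero_smul a := smul_eq_of one_ne_zero (n := 1) (m := 0) (by simp) (by simp)
  smul_add r a b := smul_eq_of (n := r.den) (m := r.num) r.den_ne_zero (Rat.mul_den_eq_num r)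
    (by rw [nsmul_add, den_nsmul_smul, den_nsmul_smul, zsmul_add])
  add_smul r s a := by
    refine smul_eq_of (n := r.den * s.den) (m := s.den * r.num + r.den * s.num)
      (mul_ne_zero r.den_ne_zero s.den_ne_zero) ?_ ?_
    · push_cast
      rw [← Rat.mul_den_eq_num r, ← Rat.mul_den_eq_num s]; ring
    · rw [nsmul_add, mul_nsmul' (s • a), den_nsmul_smul, mul_comm r.den, mul_nsmul' (r • a),
        den_nsmul_smul, add_zsmul, mul_zsmul, mul_zsmul, natCast_zsmul, natCast_zsmul]

/-- `d(a)`: the least degree of a representative of the class `a`. -/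
def minDeg (a : AlgModTors) : ℕ := sInf {n | ∃ α : Qbarˣ, cls α = a ∧ deg (α : Qbar) = n}

/-- The `L^p` Weil height of a class: the value of `h_p` at a representative. The representative
does not matter, since `h_p` is constant on classes modulo torsion. -/
def clsHeight (p : ℝ≥0∞) (a : AlgModTors) : ℝ := height p (Quotient.out (Additive.toMul a))

/-- The minimal logarithmic `L^p` Mahler measure `m_p(a) = d(a) * h_p(a)` on `𝒢`. -/
def minMahler (p : ℝ≥0∞) (a : AlgModTors) : ℝ := (minDeg a : ℝ) * clsHeight p a

/-- The norm height associated to `f : 𝒢 → [0, ∞)`: the infimum of `∑ |r_i| f(a_i)` over all ways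
of writing `a` as a linear combination `∑ r_i a_i` (multiplicatively, `∏ a_i ^ r_i`). -/
def normHeight (f : AlgModTors → ℝ) (a : AlgModTors) : ℝ :=
  sInf {s : ℝ | ∃ (n : ℕ) (r : Fin n → ℚ) (b : Fin n → AlgModTors),
    a = ∑ i, r i • b i ∧ s = ∑ i, |(r i : ℝ)| * f (b i)}

/-- The extremal norm `m̃_p` on `𝒢`. -/
def extremalNorm (p : ℝ≥0∞) : AlgModTors → ℝ := normHeight (minMahler p)

/-- The set `𝒜` of nontrivial classes that have a representative `α` such that `α` is an algebraic
unit, `[ℚ(α ^ n) : ℚ] = [ℚ(α) : ℚ]` for all `n ≥ 1`, and the norm of `α` from `ℚ(α)` to any proper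
subfield is a root of unity. -/
def setA : Set AlgModTors :=
  {a | a ≠ 0 ∧ ∃ α : Qbarˣ, cls α = a ∧
    (IsIntegral ℤ (α : Qbar) ∧ IsIntegral ℤ ((α⁻¹ : Qbarˣ) : Qbar)) ∧
    (∀ n : ℕ, 1 ≤ n → deg ((α : Qbar) ^ n) = deg (α : Qbar)) ∧
    (∀ F : IntermediateField ℚ ℚ⟮(α : Qbar)⟯, F ≠ ⊤ →
      IsOfFinOrder (Algebra.norm F (IntermediateField.AdjoinSimple.gen ℚ (α : Qbar))))}

/-! ## The lower bounds -/

/-- `m̃_p` is bounded away from zero on `𝒜`. -/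
def ExtremalBound (p : ℝ≥0∞) : Prop :=
  ∃ c : ℝ, 0 < c ∧ ∀ a ∈ setA, c ≤ extremalNorm p a

/-- The `L^p` Lehmer bound: `m_p` is bounded away from zero on the algebraic numbers that are
neither zero nor a root of unity. -/
def LpLehmerBound (p : ℝ≥0∞) : Prop :=
  ∃ c : ℝ, 0 < c ∧ ∀ α : Qbarˣ, α ∉ CommGroup.torsion Qbarˣ → c ≤ mahler p α

/-- Lehmer's conjecture: the logarithmic Mahler measure `(deg α) * h(α)` is bounded away from zero
on the algebraic numbers that are neither zero nor a root of unity. -/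
def LehmerConjecture : Prop :=
  ∃ c : ℝ, 0 < c ∧ ∀ α : Qbarˣ, α ∉ CommGroup.torsion Qbarˣ →
    c ≤ (deg (α : Qbar) : ℝ) * weilHeight α

/-- The Schinzel–Zassenhaus conjecture: for some absolute constant `c > 0`, every algebraic integer
`α` that is neither zero nor a root of unity has a conjugate of modulus at least
`1 + c / deg α`. -/
def SchinzelZassenhausConjecture : Prop :=
  ∃ c : ℝ, 0 < c ∧ ∀ α : Qbarˣ, IsIntegral ℤ (α : Qbar) → α ∉ CommGroup.torsion Qbarˣ →
    1 + c / (deg (α : Qbar) : ℝ) ≤ house (α : Qbar)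

end ExtremalNorm

end

open scoped ENNReal IntermediateField

noncomputable section

namespace ExtremalNorm

section

open NumberField Module

/-! ### Finite places, and the height of nonunits. -/

section Places

variable {K : Type*} [Field K] [NumberField K]

/-! If `α` is not a unit, one finite place already forces `m_p(α) ≥ log 2`
(`log_two_le_of_not_unit`). If `α` is a unit but not a root of unity, let `K = ℚ(α)` and choose a
number field `F` below `K`, of least degree, to which the norm `β` of `α` is not a root of unity. By
transitivity of the norm, minimality of `F` puts the class of `β` in `𝒜`
(`cls_mem_setA_of_minimal`). Taking the norm multiplies the height by at most `[K : F]`, while the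
degree falls to at most `[F : ℚ]`, so `m_p(β) ≤ m_p(α)` (`heightIn_norm_le`, `mahler_le_of_norm`).
Since the extremal norm is at most `m_p`, the hypothesis bounds `m_p(α)` from below.

For `p = 1` the product formula gives `h_1 = 2h`. For `p = ∞`, `h_∞` also sees conjugates of small
modulus. If `α⁻¹` is a conjugate of the unit `α`, these are inverses of large ones and `h_∞ ≤ log`
house. Otherwise the minimal polynomial is nonreciprocal, and Smyth's argument with Blaschke
products bounds its Mahler measure away from `1` (`five_le_of_not_reciprocal`). Nonunit integers
have norm of modulus at least `2`. -/

/-- `x` is a nonzero algebraic unit. -/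
structure IsAlgUnit (x : K) : Prop where
  ne_zero : x ≠ 0
  isIntegral : IsIntegral ℤ x
  isIntegral_inv : IsIntegral ℤ x⁻¹

theorem finitePlace_le_one_of_isIntegral (v : FinitePlace K) {x : K} (hx : IsIntegral ℤ x) :
    v x ≤ 1 := by
  have := FinitePlace.norm_le_one K v.maximalIdeal (⟨x, hx⟩ : 𝓞 K)
  rwa [FinitePlace.norm_embedding_eq] at this

theorem IsAlgUnit.finitePlace_eq_one {x : K} (hx : IsAlgUnit x) (v : FinitePlace K) :
    v x = 1 := by
  have h1 := finitePlace_le_one_of_isIntegral v hx.isIntegral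
  have h2 := finitePlace_le_one_of_isIntegral v hx.isIntegral_inv
  rw [map_inv₀] at h2
  exact le_antisymm h1 ((inv_le_one₀ (FinitePlace.pos_iff.mpr hx.ne_zero)).mp h2)

theorem isIntegral_of_finitePlace_le_one {x : K} (h : ∀ v : FinitePlace K, v x ≤ 1) :
    IsIntegral ℤ x := by
  obtain ⟨y, rfl⟩ := IsDedekindDomain.HeightOneSpectrum.mem_integers_of_valuation_le_one
    (R := 𝓞 K) K x (fun v => by
      have h1 : NumberField.HeightOneSpectrum.adicAbv K v x ≤ 1 := by
        rw [← FinitePlace.norm_embedding]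
        exact h (FinitePlace.mk v)
      rw [HeightOneSpectrum.adicAbv_def] at h1
      exact (WithZeroMulInt.toNNReal_le_one_iff
        (HeightOneSpectrum.one_lt_absNorm_nnreal v)).mp (by exact_mod_cast h1))
  exact y.2

theorem exists_finitePlace_ne_one {x : K} (h0 : x ≠ 0) (hx : ¬ IsAlgUnit x) :
    ∃ v : FinitePlace K, v x ≠ 1 := by
  by_contra! h
  exact hx ⟨h0, isIntegral_of_finitePlace_le_one fun v => (h v).le,
    isIntegral_of_finitePlace_le_one fun v => by rw [map_inv₀, h v, inv_one]⟩

/-- In the normalization of `FinitePlace`, `v x` is an integral power of the norm of the prime,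
which is at least `2`; the exponent is nonzero because `v x ≠ 1`. -/
theorem log_two_le_abs_log_finitePlace {x : K} (h0 : x ≠ 0) {v : FinitePlace K} (hv : v x ≠ 1) :
    Real.log 2 ≤ |Real.log (v x)| := by
  have hN : (2 : ℝ) ≤ (v.maximalIdeal.asIdeal.absNorm : ℝ) := by
    exact_mod_cast HeightOneSpectrum.one_lt_absNorm v.maximalIdeal
  have key : ∀ y : 𝓞 K, y ≠ 0 → ∃ n : ℕ,
      Real.log (v y) = - (n * Real.log (v.maximalIdeal.asIdeal.absNorm : ℝ)) := by
    intro y hy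
    have h := FinitePlace.apply_mul_absNorm_pow_eq_one v hy
    refine ⟨multiplicity v.maximalIdeal.asIdeal (Ideal.span {y}), ?_⟩
    rw [eq_inv_of_mul_eq_one_left h, Real.log_inv, Real.log_pow]
  rcases IsFractionRing.div_surjective (𝓞 K) x with ⟨a, b, hb, rfl⟩
  have hb0 : b ≠ 0 := nonZeroDivisors.ne_zero hb
  have ha0 : a ≠ 0 := by rintro rfl; simp at h0
  obtain ⟨m, hm⟩ := key a ha0
  obtain ⟨n, hn⟩ := key b hb0
  have hva : v (a : K) ≠ 0 := (FinitePlace.pos_iff.mpr (by simpa using ha0)).ne'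
  have hvb : v (b : K) ≠ 0 := (FinitePlace.pos_iff.mpr (by simpa using hb0)).ne'
  have hlog : Real.log (v (algebraMap (𝓞 K) K a / algebraMap (𝓞 K) K b)) =
      ((n : ℤ) - (m : ℤ) : ℤ) * Real.log (v.maximalIdeal.asIdeal.absNorm : ℝ) := by
    rw [map_div₀, Real.log_div hva hvb, hm, hn]
    push_cast; ring
  have hne : (n : ℤ) - m ≠ 0 := by
    intro h
    rw [h, Int.cast_zero, zero_mul, map_div₀] at hlog
    have hpos : 0 < v (a : K) / v (b : K) :=
      div_pos (hva.lt_of_le' (apply_nonneg _ _)) (hvb.lt_of_le' (apply_nonneg _ _))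
    exact hv (by rw [map_div₀]; exact Real.eq_one_of_pos_of_log_eq_zero hpos hlog)
  rw [hlog, abs_mul, ← Int.cast_abs]
  have h1 : (1 : ℝ) ≤ (|(n : ℤ) - m| : ℤ) := by exact_mod_cast Int.one_le_abs hne
  have h2 : Real.log 2 ≤ |Real.log (v.maximalIdeal.asIdeal.absNorm : ℝ)| :=
    (Real.log_le_log two_pos hN).trans (le_abs_self _)
  nlinarith [Real.log_pos one_lt_two, abs_nonneg (Real.log (v.maximalIdeal.asIdeal.absNorm : ℝ))]

theorem localDegree_finite_pos (v : FinitePlace K) : 0 < Place.localDegree (Sum.inr v) :=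
  Nat.mul_pos (Ideal.ramificationIdx_pos _ _) (Ideal.inertiaDeg_pos _ _)

/-- The local degree is a single term of `∑ e f = [K : ℚ]`. -/
theorem localDegree_finite_le (v : FinitePlace K) :
    Place.localDegree (Sum.inr v) ≤ finrank ℚ K := by
  set q := v.maximalIdeal.asIdeal
  have : q.IsMaximal := v.maximalIdeal.isMaximal
  have hmax : (q.under ℤ).IsMaximal := inferInstance
  have : Fintype ((q.under ℤ).primesOver (𝓞 K)) :=
    (IsDedekindDomain.primesOver_finite (q.under ℤ) (𝓞 K)).fintype
  rw [← RingOfIntegers.rank K, ← Ideal.sum_ramification_inertia_eq_finrank (q.under ℤ) (𝓞 K)]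
  exact Finset.single_le_sum
    (f := fun q' : (q.under ℤ).primesOver (𝓞 K) => q'.1.ramificationIdx ℤ * q'.1.inertiaDeg ℤ)
    (fun _ _ => Nat.zero_le _)
    (Finset.mem_univ ⟨q, inferInstance, ⟨rfl⟩⟩)

theorem log_abv_finite (v : FinitePlace K) {x : K} (hx : x ≠ 0) :
    Real.log (Place.abv (Sum.inr v) x) =
      (Place.localDegree (Sum.inr v) : ℝ)⁻¹ * Real.log (v x) :=
  Real.log_rpow (FinitePlace.pos_iff.mpr hx) _

theorem log_abv_finite_of_unit (v : FinitePlace K) {x : K} (hx : IsAlgUnit x) :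
    Real.log (Place.abv (Sum.inr v) x) = 0 := by
  rw [log_abv_finite v hx.ne_zero, hx.finitePlace_eq_one, Real.log_one, mul_zero]

/-- Ensures that the sums and suprema defining heights are genuine, not the default values of
`finsum` and `⨆`. -/
theorem finite_log_abv_ne_zero {x : K} (hx : x ≠ 0) :
    {v : Place K | Real.log (v.abv x) ≠ 0}.Finite := by
  have h1 : {v : FinitePlace K | v x ≠ 1}.Finite := FinitePlace.hasFiniteMulSupport hx
  refine ((Set.finite_range (Sum.inl : InfinitePlace K → Place K)).union
    (h1.image Sum.inr)).subset ?_
  rintro (v | v) hv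
  · exact Or.inl ⟨v, rfl⟩
  · refine Or.inr ⟨v, ?_, rfl⟩
    intro h
    apply hv
    rw [log_abv_finite v hx, h, Real.log_one, mul_zero]

theorem bddAbove_abs_log_abv {x : K} (hx : x ≠ 0) :
    BddAbove (Set.range fun v : Place K => |Real.log (v.abv x)|) := by
  refine (((finite_log_abv_ne_zero hx).image fun v : Place K => |Real.log (v.abv x)|).union
    (Set.finite_singleton (0 : ℝ))).bddAbove.mono ?_
  rintro _ ⟨v, rfl⟩
  by_cases h : Real.log (v.abv x) = 0
  · right; simp [h]
  · exact Or.inl ⟨v, h, rfl⟩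

theorem heightIn_nonneg (p : ℝ≥0∞) (x : K) : 0 ≤ heightIn p x := by
  unfold heightIn
  split_ifs
  · exact Real.iSup_nonneg fun _ => abs_nonneg _
  · exact Real.rpow_nonneg (finsum_nonneg fun _ => by positivity) _

theorem toReal_ge_one {p : ℝ≥0∞} (h1 : 1 ≤ p) (hp : p ≠ ∞) : 1 ≤ p.toReal := by
  have := ENNReal.toReal_mono hp h1
  simpa using this

theorem log_two_le_of_not_unit {p : ℝ≥0∞} (hp : 1 ≤ p) {x : K} (h0 : x ≠ 0)
    (hx : ¬ IsAlgUnit x) : Real.log 2 ≤ finrank ℚ K * heightIn p x := by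
  obtain ⟨v, hv⟩ := exists_finitePlace_ne_one h0 hx
  have hlog := log_two_le_abs_log_finitePlace h0 hv
  have hd : (0 : ℝ) < finrank ℚ K := by exact_mod_cast finrank_pos
  have hdv : (0 : ℝ) < Place.localDegree (Sum.inr v) := by exact_mod_cast localDegree_finite_pos v
  have hle : (Place.localDegree (Sum.inr v) : ℝ) ≤ finrank ℚ K := by
    exact_mod_cast localDegree_finite_le v
  have habv : |Real.log (Place.abv (Sum.inr v) x)| =
      |Real.log (v x)| / Place.localDegree (Sum.inr v) := by
    rw [log_abv_finite v h0, abs_mul, abs_of_pos (inv_pos.mpr hdv)]; ring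
  rw [← div_le_iff₀' hd]
  unfold heightIn
  split_ifs with hpt
  · refine le_trans ?_ (le_ciSup (bddAbove_abs_log_abv h0) (Sum.inr v))
    rw [habv]
    exact div_le_div₀ (abs_nonneg _) hlog hdv hle
  · have hp1 := toReal_ge_one hp hpt
    have hp0 : 0 < p.toReal := by linarith
    have hfin : (Function.support fun w : Place K => (w.localDegree : ℝ) / (finrank ℚ K : ℝ) *
        |Real.log (w.abv x)| ^ p.toReal).Finite := by
      refine (finite_log_abv_ne_zero h0).subset fun w hw h => hw ?_
      simp only [h, abs_zero, Real.zero_rpow hp0.ne', mul_zero]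
    have hsingle := single_le_finsum (Sum.inr v : Place K) hfin (fun _ => by positivity)
    rw [Real.le_rpow_inv_iff_of_pos (by positivity) (finsum_nonneg fun _ => by positivity) hp0]
    refine le_trans ?_ hsingle
    set r : ℝ := (Place.localDegree (Sum.inr v) : ℝ) / finrank ℚ K
    have hr0 : 0 < r := by positivity
    have hr1 : r ≤ 1 := (div_le_one hd).mpr hle
    -- The weight `r` can be moved inside the power, since `r ^ p ≤ r` for `r ≤ 1 ≤ p`; there it
    -- cancels the local degree in the normalization of `‖x‖_v`.
    calc (Real.log 2 / finrank ℚ K) ^ p.toReal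
        ≤ (r * |Real.log (Place.abv (Sum.inr v) x)|) ^ p.toReal := by
          refine Real.rpow_le_rpow (by positivity) ?_ hp0.le
          rw [habv]
          have : r * (|Real.log (v x)| / Place.localDegree (Sum.inr v)) =
            |Real.log (v x)| / finrank ℚ K := by simp only [r]; field_simp
          rw [this]
          gcongr
      _ = r ^ p.toReal * |Real.log (Place.abv (Sum.inr v) x)| ^ p.toReal :=
          Real.mul_rpow hr0.le (abs_nonneg _)
      _ ≤ _ := by
          gcongr
          simpa using Real.rpow_le_rpow_of_exponent_ge hr0 hr1 hp1

end Places

/-! ### Heights of units in terms of complex embeddings. -/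

section Embeddings

variable {K : Type*} [Field K] [NumberField K]

/-- Exactly `v.mult` embeddings induce the place `v`. Embeddings are preferable to places here
because norms are products over them. -/
theorem sum_mult_mul_eq_sum_embeddings (f : InfinitePlace K → ℝ) :
    ∑ v : InfinitePlace K, (v.mult : ℝ) * f v = ∑ σ : K →+* ℂ, f (InfinitePlace.mk σ) := by
  classical
  rw [← Finset.univ.sum_fiberwise (fun σ : K →+* ℂ => InfinitePlace.mk σ)]
  refine Finset.sum_congr rfl fun v _ => ?_
  rw [Finset.sum_congr rfl (g := fun _ => f v) (fun σ hσ => by rw [(Finset.mem_filter.mp hσ).2]),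
    Finset.sum_const, InfinitePlace.card_filter_mk_eq, nsmul_eq_mul]

/-- The `p`-th power of the height of a unit is an average over the complex embeddings. -/
theorem heightIn_of_unit {p : ℝ≥0∞} (hp1 : 1 ≤ p) (hp : p ≠ ∞) {x : K} (hx : IsAlgUnit x) :
    heightIn p x =
      ((∑ σ : K →+* ℂ, |Real.log ‖σ x‖| ^ p.toReal) / finrank ℚ K) ^ (p.toReal)⁻¹ := by
  have hp0 : p.toReal ≠ 0 := by linarith [toReal_ge_one hp1 hp]
  rw [heightIn, if_neg hp]
  congr 1
  classical
  rw [finsum_eq_sum_of_support_subset (s := (Finset.univ : Finset (InfinitePlace K)).map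
    ⟨Sum.inl, Sum.inl_injective⟩), Finset.sum_map]
  · have h := sum_mult_mul_eq_sum_embeddings fun v : InfinitePlace K =>
      |Real.log (v x)| ^ p.toReal
    simp only [InfinitePlace.apply] at h
    rw [← h, Finset.sum_div]
    refine Finset.sum_congr rfl fun v _ => ?_
    simp only [Place.localDegree, Place.abv, Function.Embedding.coeFn_mk]
    ring
  · rintro (v | v) hv
    · simp
    · refine absurd ?_ hv
      simp only [log_abv_finite_of_unit v hx, abs_zero, Real.zero_rpow hp0, mul_zero]

theorem heightIn_top_of_unit {x : K} (hx : IsAlgUnit x) :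
    heightIn ∞ x = ⨆ σ : K →+* ℂ, |Real.log ‖σ x‖| := by
  rw [heightIn, if_pos rfl]
  have hb : BddAbove (Set.range fun σ : K →+* ℂ => |Real.log ‖σ x‖|) :=
    (Set.finite_range _).bddAbove
  apply le_antisymm
  · refine Real.iSup_le ?_ (Real.iSup_nonneg fun _ => abs_nonneg _)
    rintro (v | v)
    · rw [Place.abv, ← InfinitePlace.norm_embedding_eq]
      exact le_ciSup hb v.embedding
    · rw [log_abv_finite_of_unit v hx, abs_zero]
      exact Real.iSup_nonneg fun _ => abs_nonneg _
  · exact ciSup_le fun σ => le_ciSup (bddAbove_abs_log_abv hx.ne_zero)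
      (Sum.inl (InfinitePlace.mk σ))

end Embeddings

end

section

open NumberField Module

/-! ### Units, norms and heights under field extension. -/

section Units

variable {K L : Type*} [Field K] [Field L]

theorem IsAlgUnit.map {x : K} (hx : IsAlgUnit x) (f : K →+* L) : IsAlgUnit (f x) where
  ne_zero := by simpa using hx.ne_zero
  isIntegral := hx.isIntegral.map f.toIntAlgHom
  isIntegral_inv := by
    rw [← map_inv₀]
    exact hx.isIntegral_inv.map f.toIntAlgHom

theorem IsAlgUnit.of_map {x : K} (f : K →+* L) (hx : IsAlgUnit (f x)) : IsAlgUnit x where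
  ne_zero := by rintro rfl; exact hx.ne_zero (map_zero f)
  isIntegral := (isIntegral_algHom_iff f.toIntAlgHom f.injective).mp hx.isIntegral
  isIntegral_inv := by
    have := hx.isIntegral_inv
    rw [← map_inv₀] at this
    exact (isIntegral_algHom_iff f.toIntAlgHom f.injective).mp this

end Units

section Extension

variable {K L : Type*} [Field K] [NumberField K] [Field L] [NumberField L] [Algebra K L]

-- With `ℂ` regarded as a `K`-algebra through `σ`, the `K`-algebra maps `L → ℂ` are the ring maps
-- lying over `σ`. The same dictionary yields the count in `card_embeddings_over`.
open scoped Classical in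
theorem map_norm_eq_prod_embeddings (σ : K →+* ℂ) (x : L) :
    σ (Algebra.norm K x) = ∏ τ : L →+* ℂ with τ.comp (algebraMap K L) = σ, τ x := by
  have : FiniteDimensional K L := Module.Finite.of_restrictScalars_finite ℚ K L
  let := σ.toAlgebra
  have h := Algebra.norm_eq_prod_embeddings K ℂ x
  refine h.trans ?_
  refine Finset.prod_bij' (fun φ _ => φ.toRingHom)
    (fun τ hτ => { toRingHom := τ, commutes' := fun r => ?_ }) ?_ ?_ ?_ ?_ ?_
  · exact RingHom.congr_fun (Finset.mem_filter.mp hτ).2 r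
  · intro φ _
    exact Finset.mem_filter.mpr ⟨Finset.mem_univ _, RingHom.ext fun r => φ.commutes r⟩
  · intros; exact Finset.mem_univ _
  · intros; rfl
  · intros; rfl
  · intros; rfl

open scoped Classical in
theorem card_embeddings_over (σ : K →+* ℂ) :
    (Finset.univ.filter fun τ : L →+* ℂ => τ.comp (algebraMap K L) = σ).card = finrank K L := by
  have : FiniteDimensional K L := Module.Finite.of_restrictScalars_finite ℚ K L
  let := σ.toAlgebra
  rw [← AlgHom.card K L ℂ, ← Finset.card_univ]
  symm
  refine Finset.card_bij' (fun φ _ => φ.toRingHom)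
    (fun τ hτ => { toRingHom := τ, commutes' := fun r => ?_ }) ?_ ?_ ?_ ?_
  · exact RingHom.congr_fun (Finset.mem_filter.mp hτ).2 r
  · intro φ _
    exact Finset.mem_filter.mpr ⟨Finset.mem_univ _, RingHom.ext fun r => φ.commutes r⟩
  · intros; exact Finset.mem_univ _
  · intros; rfl
  · intros; rfl

theorem finrank_pos_of_numberField : 0 < finrank K L := by
  have : FiniteDimensional K L := Module.Finite.of_restrictScalars_finite ℚ K L
  exact finrank_pos

theorem exists_embedding_over (σ : K →+* ℂ) : ∃ τ : L →+* ℂ, τ.comp (algebraMap K L) = σ := by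
  classical
  have h : 0 < (Finset.univ.filter fun τ : L →+* ℂ => τ.comp (algebraMap K L) = σ).card := by
    rw [card_embeddings_over]; exact finrank_pos_of_numberField
  obtain ⟨τ, hτ⟩ := Finset.card_pos.mp h
  exact ⟨τ, (Finset.mem_filter.mp hτ).2⟩

theorem sum_embeddings_comp (f : (K →+* ℂ) → ℝ) :
    ∑ τ : L →+* ℂ, f (τ.comp (algebraMap K L)) = finrank K L * ∑ σ, f σ := by
  classical
  rw [← Finset.univ.sum_fiberwise (fun τ : L →+* ℂ => τ.comp (algebraMap K L)), Finset.mul_sum]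
  refine Finset.sum_congr rfl fun σ _ => ?_
  rw [Finset.sum_congr rfl (g := fun _ => f σ) (fun τ hτ => by rw [(Finset.mem_filter.mp hτ).2]),
    Finset.sum_const, card_embeddings_over, nsmul_eq_mul]

theorem IsAlgUnit.norm {x : L} (hx : IsAlgUnit x) : IsAlgUnit (Algebra.norm K x) where
  ne_zero := by
    have : FiniteDimensional K L := Module.Finite.of_restrictScalars_finite ℚ K L
    exact Algebra.norm_ne_zero_iff.mpr hx.ne_zero
  isIntegral := by
    have : FiniteDimensional K L := Module.Finite.of_restrictScalars_finite ℚ K L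
    exact Algebra.isIntegral_norm K hx.isIntegral
  isIntegral_inv := by
    have : FiniteDimensional K L := Module.Finite.of_restrictScalars_finite ℚ K L
    have h : Algebra.norm K x⁻¹ = (Algebra.norm K x)⁻¹ := by
      apply eq_inv_of_mul_eq_one_left
      rw [← map_mul, inv_mul_cancel₀ hx.ne_zero, map_one]
    rw [← h]
    exact Algebra.isIntegral_norm K hx.isIntegral_inv

/-- The height of a unit depends only on the absolute values of its conjugates. -/
theorem heightIn_congr_of_unit {p : ℝ≥0∞} (hp : 1 ≤ p) {x y : K} (hx : IsAlgUnit x)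
    (hy : IsAlgUnit y) (h : ∀ σ : K →+* ℂ, ‖σ x‖ = ‖σ y‖) : heightIn p x = heightIn p y := by
  by_cases hpt : p = ∞
  · subst hpt
    simp only [heightIn_top_of_unit hx, heightIn_top_of_unit hy, h]
  · simp only [heightIn_of_unit hp hpt hx, heightIn_of_unit hp hpt hy, h]

theorem finrank_mul_finrank_rat : (finrank ℚ K : ℝ) * finrank K L = finrank ℚ L := by
  have : FiniteDimensional K L := Module.Finite.of_restrictScalars_finite ℚ K L
  exact_mod_cast Module.finrank_mul_finrank ℚ K L

/-- The height of a unit does not depend on the number field in which it is computed. -/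
theorem heightIn_algebraMap {p : ℝ≥0∞} (hp : 1 ≤ p) {x : K} (hx : IsAlgUnit x) :
    heightIn p (algebraMap K L x) = heightIn p x := by
  have hx' := hx.map (algebraMap K L)
  by_cases hpt : p = ∞
  · subst hpt
    rw [heightIn_top_of_unit hx, heightIn_top_of_unit hx']
    apply le_antisymm
    · exact ciSup_le fun τ => le_ciSup (f := fun σ : K →+* ℂ => |Real.log ‖σ x‖|)
        (Set.finite_range _).bddAbove (τ.comp (algebraMap K L))
    · refine ciSup_le fun σ => ?_
      obtain ⟨τ, rfl⟩ := exists_embedding_over (L := L) σ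
      exact le_ciSup (f := fun τ : L →+* ℂ => |Real.log ‖τ (algebraMap K L x)‖|)
        (Set.finite_range _).bddAbove τ
  · rw [heightIn_of_unit hp hpt hx, heightIn_of_unit hp hpt hx']
    congr 1
    have h := sum_embeddings_comp (L := L) fun σ : K →+* ℂ => |Real.log ‖σ x‖| ^ p.toReal
    simp only [RingHom.comp_apply] at h
    rw [h, ← finrank_mul_finrank_rat (K := K) (L := L), mul_comm (finrank ℚ K : ℝ)]
    have : (finrank K L : ℝ) ≠ 0 := by exact_mod_cast finrank_pos_of_numberField.ne'
    rw [mul_div_mul_left _ _ this]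

open scoped Classical in
theorem abs_log_norm_le (σ : K →+* ℂ) {x : L} (hx : x ≠ 0) :
    |Real.log ‖σ (Algebra.norm K x)‖| ≤
      ∑ τ : L →+* ℂ with τ.comp (algebraMap K L) = σ, |Real.log ‖τ x‖| := by
  rw [map_norm_eq_prod_embeddings, norm_prod, Real.log_prod]
  · exact Finset.abs_sum_le_sum_abs _ _
  · intro τ _
    simpa using hx

/-- Each conjugate of the norm is a product of `[L : K]` conjugates of `x`, so its logarithm is a
sum of that many terms. The power mean inequality over each fibre, with constant `n ^ (q - 1)`, then
gives the factor `n = [L : K]`. -/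
theorem heightIn_norm_le {p : ℝ≥0∞} (hp : 1 ≤ p) {x : L} (hx : IsAlgUnit x) :
    heightIn p (Algebra.norm K x) ≤ finrank K L * heightIn p x := by
  classical
  have hx' : IsAlgUnit (Algebra.norm K x) := hx.norm
  by_cases hpt : p = ∞
  · subst hpt
    rw [heightIn_top_of_unit hx, heightIn_top_of_unit hx']
    refine ciSup_le fun σ => (abs_log_norm_le σ hx.ne_zero).trans ?_
    rw [← card_embeddings_over (L := L) σ, ← nsmul_eq_mul]
    exact Finset.sum_le_card_nsmul _ _ _ fun τ _ =>
      le_ciSup (f := fun τ : L →+* ℂ => |Real.log ‖τ x‖|) (Set.finite_range _).bddAbove τ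
  · rw [heightIn_of_unit hp hpt hx, heightIn_of_unit hp hpt hx']
    have hp1 := toReal_ge_one hp hpt
    set q := p.toReal
    have hq0 : 0 < q := by linarith
    set n : ℝ := (finrank K L : ℝ)
    have hn : 0 < n := by simp only [n]; exact_mod_cast finrank_pos_of_numberField
    have hd : (0 : ℝ) < finrank ℚ K := by exact_mod_cast finrank_pos
    have hsum : ∑ σ : K →+* ℂ, |Real.log ‖σ (Algebra.norm K x)‖| ^ q ≤
        n ^ (q - 1) * ∑ τ : L →+* ℂ, |Real.log ‖τ x‖| ^ q := by
      rw [← Finset.univ.sum_fiberwise (fun τ : L →+* ℂ => τ.comp (algebraMap K L)),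
        Finset.mul_sum]
      refine Finset.sum_le_sum fun σ _ => ?_
      refine (Real.rpow_le_rpow (abs_nonneg _) (abs_log_norm_le σ hx.ne_zero) hq0.le).trans ?_
      have := Real.rpow_sum_le_const_mul_sum_rpow
        (Finset.univ.filter fun τ : L →+* ℂ => τ.comp (algebraMap K L) = σ)
        (fun τ => Real.log ‖τ x‖) hp1
      rwa [card_embeddings_over] at this
    have hS : 0 ≤ ∑ τ : L →+* ℂ, |Real.log ‖τ x‖| ^ q :=
      Finset.sum_nonneg fun _ _ => by positivity
    have hn' : n = (n ^ q) ^ q⁻¹ := (Real.rpow_rpow_inv hn.le hq0.ne').symm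
    rw [hn', ← Real.mul_rpow (by positivity) (by positivity)]
    refine Real.rpow_le_rpow (div_nonneg (Finset.sum_nonneg fun _ _ => by positivity) hd.le) ?_
      (by positivity)
    rw [← finrank_mul_finrank_rat (K := K) (L := L), div_le_iff₀ hd]
    refine hsum.trans (le_of_eq ?_)
    rw [Real.rpow_sub_one hn.ne']
    change _ = n ^ q * (_ / (_ * n)) * _
    field_simp

end Extension

end

/-! ### Classes modulo torsion, and the norm of least degree. -/

section

open NumberField Module IntermediateField

/-- The number `α` as an element of the number field it generates. -/
abbrev genOf (α : Qbar) : ℚ⟮α⟯ := AdjoinSimple.gen ℚ α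

theorem isAlgUnit_genOf {α : Qbar} (hα : IsAlgUnit α) : IsAlgUnit (genOf α) :=
  IsAlgUnit.of_map (algebraMap ℚ⟮α⟯ Qbar) hα

theorem height_eq_of_mem {p : ℝ≥0∞} (hp : 1 ≤ p) {α : Qbarˣ} (hα : IsAlgUnit (α : Qbar))
    {L : IntermediateField ℚ Qbar} [NumberField L] (h : (α : Qbar) ∈ L) :
    height p α = heightIn p (⟨α, h⟩ : L) := by
  have hle : ℚ⟮(α : Qbar)⟯ ≤ L := by simpa using h
  let := (inclusion hle).toRingHom.toAlgebra
  exact (heightIn_algebraMap (L := L) hp (isAlgUnit_genOf hα)).symm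

theorem isAlgUnit_mul_torsion {α ζ : Qbarˣ} (hα : IsAlgUnit (α : Qbar))
    (hζ : ζ ∈ CommGroup.torsion Qbarˣ) : IsAlgUnit ((α * ζ : Qbarˣ) : Qbar) := by
  obtain ⟨n, hn, h⟩ := isOfFinOrder_iff_pow_eq_one.mp hζ
  have h1 : (ζ : Qbar) ^ n = 1 := by simpa using congrArg Units.val h
  have hi : IsIntegral ℤ (ζ : Qbar) :=
    IsIntegral.of_pow hn (by rw [h1]; exact isIntegral_one)
  have hi' : IsIntegral ℤ (ζ : Qbar)⁻¹ :=
    IsIntegral.of_pow hn (by rw [inv_pow, h1, inv_one]; exact isIntegral_one)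
  refine ⟨Units.ne_zero _, ?_, ?_⟩
  · rw [Units.val_mul]; exact hα.isIntegral.mul hi
  · rw [Units.val_mul, mul_inv]; exact hα.isIntegral_inv.mul hi'

/-- In a field containing both numbers, `(αζ)^n = α^n` for some `n ≥ 1`, so corresponding conjugates
have equal modulus. -/
theorem height_mul_torsion {p : ℝ≥0∞} (hp : 1 ≤ p) {α ζ : Qbarˣ} (hα : IsAlgUnit (α : Qbar))
    (hζ : ζ ∈ CommGroup.torsion Qbarˣ) : height p (α * ζ) = height p α := by
  have hαζ := isAlgUnit_mul_torsion hα hζ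
  let L : IntermediateField ℚ Qbar := ℚ⟮(α : Qbar)⟯ ⊔ ℚ⟮((α * ζ : Qbarˣ) : Qbar)⟯
  have : FiniteDimensional ℚ L := IntermediateField.finiteDimensional_sup _ _
  have : NumberField L := { to_charZero := inferInstance, to_finiteDimensional := this }
  have h1 : (α : Qbar) ∈ L :=
    (le_sup_left : _ ≤ L) (mem_adjoin_simple_self ℚ _)
  have h2 : ((α * ζ : Qbarˣ) : Qbar) ∈ L :=
    (le_sup_right : _ ≤ L) (mem_adjoin_simple_self ℚ _)
  rw [height_eq_of_mem hp hα h1, height_eq_of_mem hp hαζ h2]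
  refine heightIn_congr_of_unit hp (IsAlgUnit.of_map (algebraMap L Qbar) hαζ)
    (IsAlgUnit.of_map (algebraMap L Qbar) hα) fun σ => ?_
  obtain ⟨n, hn, h⟩ := isOfFinOrder_iff_pow_eq_one.mp hζ
  have hpow : (⟨((α * ζ : Qbarˣ) : Qbar), h2⟩ : L) ^ n = (⟨α, h1⟩ : L) ^ n := by
    apply Subtype.ext
    have : (α * ζ) ^ n = α ^ n := by rw [mul_pow, h, mul_one]
    simpa using congrArg Units.val this
  have := congrArg (fun z => ‖σ z‖) hpow
  simp only [map_pow, norm_pow] at this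
  exact (pow_left_inj₀ (norm_nonneg _) (norm_nonneg _) hn.ne').mp this

theorem clsHeight_cls {p : ℝ≥0∞} (hp : 1 ≤ p) {α : Qbarˣ} (hα : IsAlgUnit (α : Qbar)) :
    clsHeight p (cls α) = height p α := by
  have h : (QuotientGroup.mk (Quotient.out (Additive.toMul (cls α))) :
      Qbarˣ ⧸ CommGroup.torsion Qbarˣ) = QuotientGroup.mk α := Quotient.out_eq _
  rw [eq_comm, QuotientGroup.eq] at h
  have := height_mul_torsion hp hα h
  rwa [mul_inv_cancel_left] at this

theorem minMahler_cls_le {p : ℝ≥0∞} (hp : 1 ≤ p) {α : Qbarˣ} (hα : IsAlgUnit (α : Qbar)) :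
    minMahler p (cls α) ≤ mahler p α := by
  rw [minMahler, mahler, clsHeight_cls hp hα]
  refine mul_le_mul_of_nonneg_right ?_ (heightIn_nonneg _ _)
  exact Nat.cast_le.mpr (Nat.sInf_le ⟨α, rfl, rfl⟩)

theorem minMahler_nonneg (p : ℝ≥0∞) (a : AlgModTors) : 0 ≤ minMahler p a :=
  mul_nonneg (Nat.cast_nonneg _) (heightIn_nonneg _ _)

/-- Uses the one-term combination `a = 1 • a`. -/
theorem normHeight_le {f : AlgModTors → ℝ} (hf : ∀ a, 0 ≤ f a) (a : AlgModTors) :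
    normHeight f a ≤ f a := by
  have hb : BddBelow {s : ℝ | ∃ (n : ℕ) (r : Fin n → ℚ) (b : Fin n → AlgModTors),
      a = ∑ i, r i • b i ∧ s = ∑ i, |(r i : ℝ)| * f (b i)} := by
    refine ⟨0, ?_⟩
    rintro _ ⟨n, r, b, -, rfl⟩
    exact Finset.sum_nonneg fun i _ => mul_nonneg (abs_nonneg _) (hf _)
  have ha : f a ∈ {s : ℝ | ∃ (n : ℕ) (r : Fin n → ℚ) (b : Fin n → AlgModTors),
      a = ∑ i, r i • b i ∧ s = ∑ i, |(r i : ℝ)| * f (b i)} :=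
    ⟨1, fun _ => 1, fun _ => a, by simp, by simp⟩
  exact csInf_le hb ha

theorem isOfFinOrder_map_iff {M N : Type*} [Field M] [Field N] (f : M →+* N) (x : M) :
    IsOfFinOrder (f x) ↔ IsOfFinOrder x :=
  Function.Injective.isOfFinOrder_iff (f := f.toMonoidHom) f.injective

theorem cls_eq_zero_iff (α : Qbarˣ) : cls α = 0 ↔ IsOfFinOrder (α : Qbar) := by
  rw [Units.isOfFinOrder_val]
  exact QuotientGroup.eq_one_iff α

/-- `b` is a root of the minimal polynomial of `ι b`. This makes the abstract field `F` an extension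
of `ℚ(ι b)`, so that norms from `F` can pass through `ℚ(ι b)` and its subfields. -/
theorem exists_lift_adjoin {F : Type*} [Field F] [NumberField F] (ι : F →+* Qbar) (b : F) :
    ∃ j : ℚ⟮ι b⟯ →+* F, j (genOf (ι b)) = b := by
  have hint : IsIntegral ℚ (ι b) := Algebra.IsIntegral.isIntegral _
  have hmem : b ∈ (minpoly ℚ (ι b)).aroots F := by
    rw [Polynomial.mem_aroots]
    refine ⟨minpoly.ne_zero hint, ι.injective ?_⟩
    have : ι (Polynomial.aeval b (minpoly ℚ (ι b))) =
        Polynomial.aeval (ι b) (minpoly ℚ (ι b)) :=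
      (Polynomial.aeval_algHom_apply ι.toRatAlgHom b _).symm
    rw [this, minpoly.aeval, map_zero]
  exact ⟨((algHomAdjoinIntegralEquiv ℚ hint).symm ⟨b, hmem⟩).toRingHom,
    algHomAdjoinIntegralEquiv_symm_apply_gen ℚ hint ⟨b, hmem⟩⟩

/-- Among the number fields `F` below `K` to which the norm of `x` is not a root of unity, there
is one of least degree. -/
theorem exists_minimal_norm {K : Type} [Field K] [NumberField K] {x : K} (hx : ¬ IsOfFinOrder x) :
    ∃ (F : Type) (_ : Field F) (_ : NumberField F) (_ : Algebra F K),
      ¬ IsOfFinOrder (Algebra.norm F x) ∧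
      ∀ (M : Type) [Field M] [NumberField M] [Algebra M K], finrank ℚ M < finrank ℚ F →
        IsOfFinOrder (Algebra.norm M x) := by
  classical
  have hex : ∃ n, ∃ (F : Type) (_ : Field F) (_ : NumberField F) (_ : Algebra F K),
      ¬ IsOfFinOrder (Algebra.norm F x) ∧ finrank ℚ F = n :=
    -- `K` itself is a candidate, because the norm from `K` to `K` is the identity.
    ⟨_, K, inferInstance, inferInstance, Algebra.id K, by simpa [Algebra.norm_self] using hx, rfl⟩
  obtain ⟨F, i1, i2, i3, h, hF⟩ := Nat.find_spec hex
  refine ⟨F, i1, i2, i3, h, fun M _ _ _ hM => ?_⟩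
  by_contra hcon
  exact Nat.find_min hex (hF ▸ hM) ⟨M, ‹_›, ‹_›, ‹_›, hcon, rfl⟩

theorem norm_norm_of_numberField {M F K : Type*} [Field M] [NumberField M] [Field F]
    [NumberField F] [Field K] [NumberField K] [Algebra M F] [Algebra F K] [Algebra M K]
    [IsScalarTower M F K] (x : K) :
    Algebra.norm M (Algebra.norm F x) = Algebra.norm M x := by
  have : FiniteDimensional M F := Module.Finite.of_restrictScalars_finite ℚ M F
  have : FiniteDimensional F K := Module.Finite.of_restrictScalars_finite ℚ F K
  exact Algebra.norm_norm

section Minimal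

variable {F K : Type} [Field F] [NumberField F] [Field K] [NumberField K] [Algebra F K] {x : K}

theorem isOfFinOrder_norm_of_minimal
    (hmin : ∀ (M : Type) [Field M] [NumberField M] [Algebra M K], finrank ℚ M < finrank ℚ F →
      IsOfFinOrder (Algebra.norm M x))
    (M : Type) [Field M] [NumberField M] [Algebra M F] (hM : finrank ℚ M < finrank ℚ F) :
    IsOfFinOrder (Algebra.norm M (Algebra.norm F x)) := by
  let : Algebra M K := ((algebraMap F K).comp (algebraMap M F)).toAlgebra
  have : IsScalarTower M F K := IsScalarTower.of_algebraMap_eq fun _ => rfl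
  rw [norm_norm_of_numberField]
  exact hmin M hM

theorem finrank_rat_le_of_ringHom {M N : Type*} [Field M] [NumberField M] [Field N]
    [NumberField N] (f : M →+* N) : finrank ℚ M ≤ finrank ℚ N :=
  LinearMap.finrank_le_finrank_of_injective (f := f.toRatAlgHom.toLinearMap) f.injective

/-- Both field conditions of `setA` follow from one fact: the norm of `b` to any field below `F` of
smaller degree is a root of unity. If `ℚ(β^n)` had smaller degree than `ℚ(β)`, the norm of `b^n` to
it would be a root of unity and also a positive power of `β^n`, making `β` torsion. For `M` properly
inside `ℚ(β)`, the norm of `b` to `M` is the `[F : ℚ(β)]`-th power of the norm of `β`. -/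
theorem cls_mem_setA_of_minimal (hx : IsAlgUnit x)
    (hmin : ∀ (M : Type) [Field M] [NumberField M] [Algebra M K], finrank ℚ M < finrank ℚ F →
      IsOfFinOrder (Algebra.norm M x))
    (hF : ¬ IsOfFinOrder (Algebra.norm F x)) (ι : F →+* Qbar) (β : Qbarˣ)
    (hβ : (β : Qbar) = ι (Algebra.norm F x)) : cls β ∈ setA := by
  set b := Algebra.norm F x with hb
  have hbu : IsAlgUnit b := hx.norm
  have hβu : IsAlgUnit (β : Qbar) := hβ ▸ hbu.map ι
  obtain ⟨j, hj⟩ : ∃ j : ℚ⟮(β : Qbar)⟯ →+* F, j (genOf (β : Qbar)) = b := by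
    rw [hβ]; exact exists_lift_adjoin ι b
  have hβF : finrank ℚ ℚ⟮(β : Qbar)⟯ ≤ finrank ℚ F := finrank_rat_le_of_ringHom j
  refine ⟨?_, β, rfl, ⟨hβu.isIntegral, ?_⟩, ?_, ?_⟩
  · rwa [Ne, cls_eq_zero_iff, hβ, isOfFinOrder_map_iff]
  · rw [Units.val_inv_eq_inv_val]; exact hβu.isIntegral_inv
  · intro n hn
    have hle : ℚ⟮(β : Qbar) ^ n⟯ ≤ ℚ⟮(β : Qbar)⟯ := by
      rw [adjoin_simple_le_iff]
      exact pow_mem (mem_adjoin_simple_self ℚ _) n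
    have h1 : deg ((β : Qbar) ^ n) ≤ deg (β : Qbar) :=
      finrank_rat_le_of_ringHom (inclusion hle).toRingHom
    refine le_antisymm h1 (not_lt.mp fun hlt => hF ?_)
    let : Algebra ℚ⟮(β : Qbar) ^ n⟯ F := (j.comp (inclusion hle).toRingHom).toAlgebra
    have halg : algebraMap ℚ⟮(β : Qbar) ^ n⟯ F (genOf ((β : Qbar) ^ n)) = b ^ n := by
      rw [← hj, ← map_pow]
      rfl
    have h2 := (isOfFinOrder_norm_of_minimal hmin ℚ⟮(β : Qbar) ^ n⟯
      (lt_of_lt_of_le hlt hβF)).pow (n := n)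
    rw [← hb, ← map_pow, ← halg, Algebra.norm_algebraMap] at h2
    have h3 := h2.of_pow finrank_pos_of_numberField.ne'
    rw [← isOfFinOrder_map_iff (algebraMap ℚ⟮(β : Qbar) ^ n⟯ F), halg] at h3
    exact h3.of_pow (by omega)
  · intro M hM
    have hlt : finrank ℚ M < finrank ℚ ℚ⟮(β : Qbar)⟯ := by
      refine lt_of_le_of_ne (finrank_rat_le_of_ringHom (algebraMap M _)) fun h => hM ?_
      refine eq_of_le_of_finrank_eq le_top ?_
      rw [h]
      exact (finrank_top' (F := ℚ) (E := ℚ⟮(β : Qbar)⟯)).symm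
    let : Algebra ℚ⟮(β : Qbar)⟯ F := j.toAlgebra
    have h2 := isOfFinOrder_norm_of_minimal hmin M (lt_of_lt_of_le hlt hβF)
    have halg : algebraMap ℚ⟮(β : Qbar)⟯ F (genOf (β : Qbar)) = b := hj
    rw [← hb, ← halg, ← norm_norm_of_numberField (F := ℚ⟮(β : Qbar)⟯), Algebra.norm_algebraMap,
      map_pow] at h2
    exact h2.of_pow finrank_pos_of_numberField.ne'

theorem mahler_le_of_norm {p : ℝ≥0∞} (hp : 1 ≤ p) (hx : IsAlgUnit x) (ι : F →+* Qbar) (β : Qbarˣ)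
    (hβ : (β : Qbar) = ι (Algebra.norm F x)) : mahler p β ≤ finrank ℚ K * heightIn p x := by
  have hbu : IsAlgUnit (Algebra.norm F x) := hx.norm
  have hβu : IsAlgUnit (β : Qbar) := hβ ▸ hbu.map ι
  obtain ⟨j, hj⟩ : ∃ j : ℚ⟮(β : Qbar)⟯ →+* F, j (genOf (β : Qbar)) = Algebra.norm F x := by
    rw [hβ]; exact exists_lift_adjoin ι _
  let : Algebra ℚ⟮(β : Qbar)⟯ F := j.toAlgebra
  have h1 : height p β = heightIn p (Algebra.norm F x) := by
    rw [← hj]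
    exact (heightIn_algebraMap (L := F) hp (isAlgUnit_genOf hβu)).symm
  have h2 : (deg (β : Qbar) : ℝ) ≤ finrank ℚ F := by
    exact_mod_cast finrank_rat_le_of_ringHom j
  rw [mahler, h1, ← finrank_mul_finrank_rat (K := F) (L := K), mul_assoc]
  exact mul_le_mul h2 (heightIn_norm_le hp hx) (heightIn_nonneg _ _) (Nat.cast_nonneg _)

end Minimal

/-- Below every algebraic unit that is not a root of unity there is a class in `setA` whose
extremal norm is bounded by the Mahler measure of that unit. -/
theorem exists_mem_setA_extremalNorm_le {p : ℝ≥0∞} (hp : 1 ≤ p) {α : Qbarˣ}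
    (hα : IsAlgUnit (α : Qbar)) (htor : α ∉ CommGroup.torsion Qbarˣ) :
    ∃ a ∈ setA, extremalNorm p a ≤ mahler p α := by
  have hx := isAlgUnit_genOf hα
  have hx' : ¬ IsOfFinOrder (genOf (α : Qbar)) := by
    rw [← isOfFinOrder_map_iff (algebraMap ℚ⟮(α : Qbar)⟯ Qbar), AdjoinSimple.algebraMap_gen,
      Units.isOfFinOrder_val]
    exact htor
  obtain ⟨F, _, _, _, hF, hmin⟩ := exists_minimal_norm hx'
  let ι : F →+* Qbar := (algebraMap ℚ⟮(α : Qbar)⟯ Qbar).comp (algebraMap F _)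
  have hb : IsAlgUnit (Algebra.norm F (genOf (α : Qbar))) := hx.norm
  let β : Qbarˣ := Units.mk0 (ι (Algebra.norm F (genOf (α : Qbar)))) (hb.map ι).ne_zero
  refine ⟨cls β, cls_mem_setA_of_minimal hx hmin hF ι β rfl, ?_⟩
  exact (normHeight_le (minMahler_nonneg p) _).trans
    ((minMahler_cls_le hp (hb.map ι)).trans (mahler_le_of_norm hp hx ι β rfl))

theorem isAlgUnit_of_genOf {α : Qbar} (h : IsAlgUnit (genOf α)) : IsAlgUnit α :=
  h.map (algebraMap ℚ⟮α⟯ Qbar)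

theorem lpLehmerBound_of_extremalBound {p : ℝ≥0∞} (hp : 1 ≤ p) (h : ExtremalBound p) :
    LpLehmerBound p := by
  obtain ⟨c, hc, hA⟩ := h
  refine ⟨min c (Real.log 2), lt_min hc (Real.log_pos one_lt_two), fun α hα => ?_⟩
  by_cases hu : IsAlgUnit (α : Qbar)
  · obtain ⟨a, ha, hle⟩ := exists_mem_setA_extremalNorm_le hp hu hα
    exact (min_le_left _ _).trans ((hA a ha).trans hle)
  · refine (min_le_right _ _).trans (log_two_le_of_not_unit hp ?_ fun h => hu (isAlgUnit_of_genOf h))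
    intro h0
    exact α.ne_zero (by simpa using congrArg (algebraMap ℚ⟮(α : Qbar)⟯ Qbar) h0)

end

/-! ### The product formula, and Lehmer's conjecture from `p = 1`. -/

section

open NumberField Module IntermediateField

section ProductFormula

variable {K : Type*} [Field K] [NumberField K]

/-- The local degree undoes the root taken in `Place.abv`, so this is the logarithm of the product
formula divided by `[K : ℚ]`. -/
theorem finsum_localDegree_mul_log {x : K} (hx : x ≠ 0) :
    ∑ᶠ v : Place K, (v.localDegree : ℝ) / (finrank ℚ K : ℝ) * Real.log (v.abv x) = 0 := by
  classical
  have hfin : (Function.mulSupport fun v : FinitePlace K => v x).Finite :=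
    FinitePlace.hasFiniteMulSupport hx
  have hterm : ∀ v : FinitePlace K, (Place.localDegree (Sum.inr v) : ℝ) / (finrank ℚ K : ℝ) *
      Real.log (Place.abv (Sum.inr v) x) = Real.log (v x) / finrank ℚ K := by
    intro v
    have : (Place.localDegree (Sum.inr v) : ℝ) ≠ 0 := by
      exact_mod_cast (localDegree_finite_pos v).ne'
    rw [log_abv_finite v hx]
    field_simp
  rw [finsum_eq_sum_of_support_subset
    (s := (Finset.univ : Finset (InfinitePlace K)).disjSum hfin.toFinset), Finset.sum_disjSum]
  · have h := prod_abs_eq_one hx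
    rw [finprod_eq_prod_of_mulSupport_subset (s := hfin.toFinset) _ (by simp)] at h
    have hinf : ∀ v : InfinitePlace K, v x ≠ 0 := fun v => (map_ne_zero v).mpr hx
    have hf : ∀ v : FinitePlace K, v x ≠ 0 := fun v => (FinitePlace.pos_iff.mpr hx).ne'
    have hl := congrArg Real.log h
    rw [Real.log_one, Real.log_mul
      (Finset.prod_ne_zero_iff.mpr fun v _ => pow_ne_zero _ (hinf v))
      (Finset.prod_ne_zero_iff.mpr fun v _ => hf v),
      Real.log_prod (fun v _ => pow_ne_zero _ (hinf v)), Real.log_prod (fun v _ => hf v)] at hl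
    simp only [hterm, ← Finset.sum_div]
    rw [← zero_div (finrank ℚ K : ℝ), ← hl, add_div]
    congr 1
    rw [Finset.sum_div]
    refine Finset.sum_congr rfl fun v _ => ?_
    rw [Real.log_pow]
    simp only [Place.localDegree, Place.abv]
    ring
  · rintro (v | v) hv
    · simp
    · simp only [Function.mem_support, hterm] at hv
      have : v x ≠ 1 := fun h => hv (by rw [h, Real.log_one, zero_div])
      simpa using this

/-- `h_1 = 2 h`, by the product formula. -/
theorem heightIn_one {x : K} (hx : x ≠ 0) : heightIn 1 x = 2 * weilHeightIn x := by
  have hs : ∀ g : ℝ → ℝ, g 0 = 0 → (Function.support fun v : Place K =>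
      (v.localDegree : ℝ) / (finrank ℚ K : ℝ) * g (Real.log (v.abv x))).Finite := fun g hg =>
    (finite_log_abv_ne_zero hx).subset fun v hv h => hv (by simp only [h, hg, mul_zero])
  have h0 := finsum_localDegree_mul_log hx
  -- Termwise `|t| = 2 max(0, t) - t`; the product formula supplies the subtracted sum as a zero.
  rw [heightIn, if_neg ENNReal.one_ne_top, weilHeightIn, ENNReal.toReal_one, inv_one,
    Real.rpow_one, ← sub_zero (2 * _), ← h0, mul_finsum,
    ← finsum_sub_distrib ((hs (fun t => 2 * max 0 t) (by simp)).subset ?_)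
      (hs (fun t => t) rfl)]
  · refine finsum_congr fun v => ?_
    rw [Real.rpow_one, Real.posLog]
    rcases le_total 0 (Real.log (v.abv x)) with h | h
    · rw [abs_of_nonneg h, max_eq_right h]; ring
    · rw [abs_of_nonpos h, max_eq_left h]; ring
  · intro v hv h
    apply hv
    simp only [Real.posLog] at h ⊢
    linarith

end ProductFormula

theorem lehmerConjecture_of_lpLehmerBound (h : LpLehmerBound 1) : LehmerConjecture := by
  obtain ⟨c, hc, hb⟩ := h
  refine ⟨c / 2, half_pos hc, fun α hα => ?_⟩
  have h1 := hb α hα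
  have h0 : genOf (α : Qbar) ≠ 0 := by
    intro h0
    exact α.ne_zero (by simpa using congrArg (algebraMap ℚ⟮(α : Qbar)⟯ Qbar) h0)
  rw [mahler, height, heightIn_one h0] at h1
  rw [weilHeight]
  linarith

end

/-! ### Blaschke products through their power series coefficients. -/

section Blaschke

open PowerSeries ComplexConjugate

/-- The sum of the squared moduli of the coefficients of `w` of index at most `n`. -/
def energy (n : ℕ) (w : ℂ⟦X⟧) : ℝ := ∑ i ∈ Finset.range (n + 1), ‖coeff i w‖ ^ 2

/-- `1 - conj a X` and `X - a` have equal modulus on the unit circle, so the difference of squared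
coefficients telescopes and truncation leaves only a boundary term. -/
theorem energy_sub (n : ℕ) (a : ℂ) (w : ℂ⟦X⟧) :
    energy n ((1 - C (conj a) * X) * w) - energy n ((X - C a) * w) =
      (1 - ‖a‖ ^ 2) * ‖coeff n w‖ ^ 2 := by
  have key : ∀ z t : ℂ, ‖z - conj a * t‖ ^ 2 - ‖t - a * z‖ ^ 2 =
      (1 - ‖a‖ ^ 2) * (‖z‖ ^ 2 - ‖t‖ ^ 2) := by
    intro z t
    simp only [← Complex.normSq_eq_norm_sq, Complex.normSq_apply, Complex.sub_re, Complex.sub_im,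
      Complex.mul_re, Complex.mul_im, Complex.conj_re, Complex.conj_im]
    ring
  induction n with
  | zero =>
    simp only [energy, zero_add, Finset.range_one, Finset.sum_singleton, sub_mul, one_mul, map_sub,
      mul_assoc, coeff_C_mul, coeff_zero_X_mul, mul_zero, sub_zero, zero_sub, norm_neg, norm_mul]
    ring
  | succ n ih =>
    have h := key (coeff (n + 1) w) (coeff n w)
    rw [energy, energy, Finset.sum_range_succ, Finset.sum_range_succ _ (n + 1)]
    change energy n _ + _ - (energy n _ + _) = _
    have h1 : coeff (n + 1) ((1 - C (conj a) * X) * w) =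
        coeff (n + 1) w - conj a * coeff n w := by
      simp only [sub_mul, one_mul, map_sub, mul_assoc, coeff_C_mul, coeff_succ_X_mul]
    have h2 : coeff (n + 1) ((X - C a) * w) = coeff n w - a * coeff (n + 1) w := by
      simp only [sub_mul, map_sub, coeff_C_mul, coeff_succ_X_mul]
    rw [h1, h2]
    linarith

/-- Factors are exchanged one at a time, the sign of the boundary term being fixed by `‖z‖ ≤ 1`.
With `w` the inverse of the right-hand product, the Blaschke product has energy at most `1`. -/
theorem energy_prod_le (n : ℕ) (s : Multiset ℂ) (hs : ∀ z ∈ s, ‖z‖ ≤ 1) (w : ℂ⟦X⟧) :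
    energy n ((s.map fun z => X - C z).prod * w) ≤
      energy n ((s.map fun z => 1 - C (conj z) * X).prod * w) := by
  induction s using Multiset.induction_on generalizing w with
  | empty => simp
  | cons a s ih =>
    have ha : ‖a‖ ≤ 1 := hs a (Multiset.mem_cons_self a s)
    have hs' : ∀ z ∈ s, ‖z‖ ≤ 1 := fun z hz => hs z (Multiset.mem_cons_of_mem hz)
    simp only [Multiset.map_cons, Multiset.prod_cons]
    have h1 := energy_sub n a ((s.map fun z => X - C z).prod * w)
    have h2 := ih hs' ((1 - C (conj a) * X) * w)
    have h3 : 0 ≤ (1 - ‖a‖ ^ 2) * ‖coeff n ((s.map fun z => X - C z).prod * w)‖ ^ 2 :=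
      mul_nonneg (by nlinarith [norm_nonneg a]) (by positivity)
    rw [mul_left_comm] at h1
    rw [mul_assoc, mul_assoc, mul_left_comm (1 - C (conj a) * X)]
    linarith

theorem le_energy_prod (n : ℕ) (s : Multiset ℂ) (hs : ∀ z ∈ s, 1 ≤ ‖z‖) (w : ℂ⟦X⟧) :
    energy n ((s.map fun z => 1 - C (conj z) * X).prod * w) ≤
      energy n ((s.map fun z => X - C z).prod * w) := by
  induction s using Multiset.induction_on generalizing w with
  | empty => simp
  | cons a s ih =>
    have ha : 1 ≤ ‖a‖ := hs a (Multiset.mem_cons_self a s)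
    have hs' : ∀ z ∈ s, 1 ≤ ‖z‖ := fun z hz => hs z (Multiset.mem_cons_of_mem hz)
    simp only [Multiset.map_cons, Multiset.prod_cons]
    have h1 := energy_sub n a ((s.map fun z => X - C z).prod * w)
    have h2 := ih hs' ((1 - C (conj a) * X) * w)
    have h3 : (1 - ‖a‖ ^ 2) * ‖coeff n ((s.map fun z => X - C z).prod * w)‖ ^ 2 ≤ 0 :=
      mul_nonpos_of_nonpos_of_nonneg (by nlinarith [norm_nonneg a]) (by positivity)
    rw [mul_left_comm] at h1
    rw [mul_assoc, mul_assoc, mul_left_comm (1 - C (conj a) * X)]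
    linarith

theorem energy_one (n : ℕ) : energy n 1 = 1 := by
  rw [energy, Finset.sum_range_succ']
  simp [coeff_one]

theorem norm_sq_add_norm_sq_le_energy {n : ℕ} (hn : n ≠ 0) (w : ℂ⟦X⟧) :
    ‖coeff 0 w‖ ^ 2 + ‖coeff n w‖ ^ 2 ≤ energy n w := by
  have h : ({0, n} : Finset ℕ) ⊆ Finset.range (n + 1) := by
    intro i hi
    simp only [Finset.mem_insert, Finset.mem_singleton] at hi
    rw [Finset.mem_range]
    omega
  have := Finset.sum_le_sum_of_subset_of_nonneg (f := fun i => ‖coeff i w‖ ^ 2) h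
    fun _ _ _ => by positivity
  rwa [Finset.sum_pair hn.symm] at this

theorem constantCoeff_prod_X_sub_C (s : Multiset ℂ) :
    ‖constantCoeff (s.map fun z => (X : ℂ⟦X⟧) - C z).prod‖ = (s.map fun z => ‖z‖).prod := by
  induction s using Multiset.induction_on with
  | empty => simp
  | cons a s ih =>
    simp only [Multiset.map_cons, Multiset.prod_cons, map_mul, norm_mul, ih]
    simp

theorem constantCoeff_prod_one_sub (s : Multiset ℂ) :
    constantCoeff (s.map fun z => (1 : ℂ⟦X⟧) - C (conj z) * X).prod = 1 := by
  induction s using Multiset.induction_on with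
  | empty => simp
  | cons a s ih =>
    simp only [Multiset.map_cons, Multiset.prod_cons, map_mul, ih]
    simp

/-- If `A` is an integral power series with constant term `1`, different from `1`, and `f`, `g` are
in the unit ball of `H^2` with constant terms of modulus `m` and `A * g = ± f`, then
`m ^ 2 ≤ 4 / 5`. -/
theorem sq_le_of_mul_eq {A : ℤ⟦X⟧} (hA0 : constantCoeff A = 1) (hA : A ≠ 1) {f g : ℂ⟦X⟧} {ε : ℂ}
    (hε : ‖ε‖ = 1) (h : A.map (Int.castRingHom ℂ) * g = C ε * f) (hf : ∀ n, energy n f ≤ 1)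
    (hg : ∀ n, energy n g ≤ 1) : 5 * ‖constantCoeff g‖ ^ 2 ≤ 4 := by
  have hA' : A - 1 ≠ 0 := sub_ne_zero.mpr hA
  obtain ⟨B, hB⟩ := X_pow_order_dvd (φ := A - 1)
  -- `k` is the first positive index at which `A` has a nonzero coefficient; that coefficient is an
  -- integer, so its modulus is at least `1`.
  set k := (A - 1).order.toNat
  have hk : k ≠ 0 := by
    intro hk
    have : coeff k (A - 1) ≠ 0 := coeff_order hA'
    rw [hk] at this
    simp [hA0] at this
  have hB0 : constantCoeff B ≠ 0 := by
    intro h0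
    have h1 : coeff k (A - 1) ≠ 0 := coeff_order hA'
    rw [hB, coeff_X_pow_mul', if_pos le_rfl, Nat.sub_self, coeff_zero_eq_constantCoeff_apply] at h1
    exact h1 h0
  have hAB : A = 1 + X ^ k * B := by rw [← hB]; ring
  have hexp : C ε * f = g + X ^ k * (B.map (Int.castRingHom ℂ) * g) := by
    rw [← h, hAB]; simp; ring
  have h0 : ε * constantCoeff f = constantCoeff g := by
    have := congrArg constantCoeff hexp
    simpa [hk] using this
  have h1 : ε * coeff k f = coeff k g + ((constantCoeff B : ℤ) : ℂ) * constantCoeff g := by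
    have := congrArg (coeff k) hexp
    rw [coeff_C_mul, map_add, coeff_X_pow_mul', if_pos le_rfl, Nat.sub_self,
      coeff_zero_eq_constantCoeff_apply, map_mul] at this
    rw [this, ← coeff_zero_eq_constantCoeff_apply, coeff_map, coeff_zero_eq_constantCoeff_apply]
    rfl
  have hBn : (1 : ℝ) ≤ ‖((constantCoeff B : ℤ) : ℂ)‖ := by
    rw [Complex.norm_intCast]
    exact_mod_cast Int.one_le_abs hB0
  have hfk := (norm_sq_add_norm_sq_le_energy hk f).trans (hf k)
  have hgk := (norm_sq_add_norm_sq_le_energy hk g).trans (hg k)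
  rw [coeff_zero_eq_constantCoeff_apply] at hfk hgk
  have hf0 : ‖constantCoeff f‖ = ‖constantCoeff g‖ := by
    rw [← h0, norm_mul, hε, one_mul]
  rw [hf0] at hfk
  have hm : ‖constantCoeff g‖ ≤ ‖coeff k f‖ + ‖coeff k g‖ := by
    calc ‖constantCoeff g‖ ≤ ‖((constantCoeff B : ℤ) : ℂ)‖ * ‖constantCoeff g‖ :=
          le_mul_of_one_le_left (norm_nonneg _) hBn
      _ = ‖ε * coeff k f - coeff k g‖ := by rw [h1, ← norm_mul]; congr 1; ring
      _ ≤ ‖ε * coeff k f‖ + ‖coeff k g‖ := norm_sub_le _ _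
      _ = _ := by rw [norm_mul, hε, one_mul]
  -- With `m = ‖g(0)‖`: `m² ≤ 2(‖f_k‖² + ‖g_k‖²) ≤ 4(1 - m²)`.
  nlinarith [sq_nonneg (‖coeff k f‖ - ‖coeff k g‖), norm_nonneg (constantCoeff g),
    norm_nonneg (coeff k f), norm_nonneg (coeff k g)]

end Blaschke

/-! ### Mahler measure of nonreciprocal integer polynomials. -/

section Smyth

open Polynomial ComplexConjugate

theorem reverse_prod_X_sub_C (s : Multiset ℂ) :
    (s.map fun z => X - C z).prod.reverse = (s.map fun z => 1 - C z * X).prod := by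
  induction s using Multiset.induction_on with
  | empty => simpa using reverse_C (1 : ℂ)
  | cons a s ih =>
    simp only [Multiset.map_cons, Multiset.prod_cons, reverse_mul_of_domain, ih]
    congr 1
    have h : (X - C a : ℂ[X]) = 1 * X + C (-a) := by simp [sub_eq_add_neg]
    rw [h, reverse_add_C, reverse_mul_X, one_mul, natDegree_X, pow_one, C_neg, neg_mul,
      ← sub_eq_add_neg]
    simpa using reverse_C (1 : ℂ)

theorem reverse_map_of_injective {R S : Type*} [Semiring R] [Semiring S] (φ : R →+* S)
    (hφ : Function.Injective φ) (P : R[X]) : (P.map φ).reverse = P.reverse.map φ := by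
  rw [reverse, reverse, natDegree_map_eq_of_injective hφ, reflect_map]

theorem map_eq_prod_roots {P : ℤ[X]} (hP : P.Monic) :
    P.map (Int.castRingHom ℂ) =
      ((P.map (Int.castRingHom ℂ)).roots.map fun z => X - C z).prod :=
  (IsAlgClosed.splits _).eq_prod_roots_of_monic (hP.map _)

/-- The coefficients are real, so conjugating the factorization of the reverse changes `1 - zX` into
the Blaschke denominator. -/
theorem map_reverse_eq_prod {P : ℤ[X]} (hP : P.Monic) :
    P.reverse.map (Int.castRingHom ℂ) =
      ((P.map (Int.castRingHom ℂ)).roots.map fun z => 1 - C (conj z) * X).prod := by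
  have h : P.reverse.map (Int.castRingHom ℂ) =
      ((P.map (Int.castRingHom ℂ)).roots.map fun z => 1 - C z * X).prod := by
    rw [← reverse_map_of_injective _ (RingHom.injective_int _), ← reverse_prod_X_sub_C,
      ← map_eq_prod_roots hP]
  have h2 := congrArg (Polynomial.map (conj : ℂ →+* ℂ)) h
  rw [Polynomial.map_map, Polynomial.map_multiset_prod, Multiset.map_map] at h2
  rw [RingHom.eq_intCast' ((conj : ℂ →+* ℂ).comp (Int.castRingHom ℂ))] at h2
  simpa using h2

/-- A weak form of a theorem of Smyth: the Mahler measure of a nonreciprocal monic integer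
polynomial with constant term `±1` is at least `√5 / 2`. -/
theorem five_le_of_not_reciprocal {P : ℤ[X]} (hP : P.Monic) {ε : ℤ} (hε : ε * ε = 1)
    (hrec : P ≠ C ε * P.reverse) (h0 : P.coeff 0 = ε) :
    5 ≤ 4 * (((P.map (Int.castRingHom ℂ)).roots.map fun z => max 1 ‖z‖).prod) ^ 2 := by
  classical
  set s := (P.map (Int.castRingHom ℂ)).roots with hs
  set sI := s.filter fun z => ‖z‖ ≤ 1
  set sO := s.filter fun z => ¬ ‖z‖ ≤ 1
  have hsum : s = sI + sO := (Multiset.filter_add_not _ s).symm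
  have hI : ∀ z ∈ sI, ‖z‖ ≤ 1 := fun z hz => (Multiset.mem_filter.mp hz).2
  have hO : ∀ z ∈ sO, 1 ≤ ‖z‖ := fun z hz => (not_le.mp (Multiset.mem_filter.mp hz).2).le
  let p : Multiset ℂ → PowerSeries ℂ := fun t =>
    (t.map fun z => PowerSeries.X - PowerSeries.C z).prod
  let q : Multiset ℂ → PowerSeries ℂ := fun t =>
    (t.map fun z => 1 - PowerSeries.C (conj z) * PowerSeries.X).prod
  have hPs : ((P.map (Int.castRingHom ℂ) : ℂ[X]) : PowerSeries ℂ) = p sI * p sO := by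
    have h := congrArg (coeToPowerSeries.ringHom (R := ℂ)) (map_eq_prod_roots hP)
    rw [map_multiset_prod, Multiset.map_map, ← hs, hsum, Multiset.map_add, Multiset.prod_add] at h
    simpa [p, Function.comp_def] using h
  have hQs : ((P.reverse.map (Int.castRingHom ℂ) : ℂ[X]) : PowerSeries ℂ) = q sI * q sO := by
    have h := congrArg (coeToPowerSeries.ringHom (R := ℂ)) (map_reverse_eq_prod hP)
    rw [map_multiset_prod, Multiset.map_map, ← hs, hsum, Multiset.map_add, Multiset.prod_add] at h
    simpa [q, Function.comp_def] using h
  have hQ1 : PowerSeries.constantCoeff (P.reverse : PowerSeries ℤ) = ((1 : ℤˣ) : ℤ) := by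
    simp [hP.leadingCoeff]
  -- `A = ε P / P.reverse` has integer coefficients since the reverse of a monic polynomial has
  -- constant term `1`. Nonreciprocity says `A ≠ 1`.
  obtain ⟨A, hAQ⟩ : ∃ A : PowerSeries ℤ,
      A * (P.reverse : PowerSeries ℤ) = PowerSeries.C ε * (P : PowerSeries ℤ) :=
    ⟨PowerSeries.C ε * P * PowerSeries.invOfUnit (P.reverse : PowerSeries ℤ) 1, by
      rw [mul_assoc, PowerSeries.invOfUnit_mul _ _ hQ1, mul_one]⟩
  have hA1 : A ≠ 1 := by
    intro h
    apply hrec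
    rw [h, one_mul] at hAQ
    have : (P.reverse : ℤ[X]) = C ε * P := by
      apply Polynomial.coe_injective
      rw [hAQ, Polynomial.coe_mul, Polynomial.coe_C]
    rw [this, ← mul_assoc, ← C_mul, hε, C_1, one_mul]
  have hA0 : PowerSeries.constantCoeff A = 1 := by
    have h := congrArg PowerSeries.constantCoeff hAQ
    rw [map_mul, map_mul, hQ1] at h
    simpa [h0, hε] using h
  have hmap : A.map (Int.castRingHom ℂ) * (q sI * q sO) =
      PowerSeries.C (ε : ℂ) * (p sI * p sO) := by
    have h := congrArg (PowerSeries.map (Int.castRingHom ℂ)) hAQ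
    rw [map_mul, map_mul, ← Polynomial.polynomial_map_coe, ← Polynomial.polynomial_map_coe, hPs,
      hQs] at h
    simpa using h
  have hqI : PowerSeries.constantCoeff (q sI) = 1 := constantCoeff_prod_one_sub sI
  have hqO : PowerSeries.constantCoeff (q sO) = 1 := constantCoeff_prod_one_sub sO
  have hpO : ‖PowerSeries.constantCoeff (p sO)‖ = (sO.map fun z => ‖z‖).prod :=
    constantCoeff_prod_X_sub_C sO
  have hM : (s.map fun z => max 1 ‖z‖).prod = (sO.map fun z => ‖z‖).prod := by
    rw [hsum, Multiset.map_add, Multiset.prod_add,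
      Multiset.map_congr rfl (g := fun _ => (1 : ℝ)) (fun z hz => max_eq_left (hI z hz)),
      Multiset.map_congr rfl (g := fun z : ℂ => ‖z‖) (fun z hz => max_eq_right (hO z hz))]
    simp
  have hM0 : (s.map fun z => max 1 ‖z‖).prod ≠ 0 := by
    refine Multiset.prod_ne_zero fun h => ?_
    obtain ⟨z, -, hz⟩ := Multiset.mem_map.mp h
    exact absurd hz (lt_of_lt_of_le one_pos (le_max_left _ _)).ne'
  have hpO0 : PowerSeries.constantCoeff (p sO) ≠ 0 := by
    rw [← norm_ne_zero_iff, hpO, ← hM]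
    exact hM0
  have hqq : q sI * (q sI)⁻¹ = 1 := PowerSeries.mul_inv_cancel _ (by rw [hqI]; exact one_ne_zero)
  have hpp : p sO * (p sO)⁻¹ = 1 := PowerSeries.mul_inv_cancel _ hpO0
  have hεn : ‖(ε : ℂ)‖ = 1 := by
    rcases mul_self_eq_one_iff.mp hε with rfl | rfl <;> simp
  -- `f` collects the roots in the closed disc and `g` is the inverted factor of the roots outside;
  -- `g` has constant term of modulus `1 / M`, with `M` the Mahler measure.
  have key := sq_le_of_mul_eq (f := p sI * (q sI)⁻¹) (g := q sO * (p sO)⁻¹) hA0 hA1 hεn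
    (by linear_combination (q sI)⁻¹ * (p sO)⁻¹ * hmap
          - A.map (Int.castRingHom ℂ) * (q sO * (p sO)⁻¹) * hqq
          + PowerSeries.C (ε : ℂ) * (p sI * (q sI)⁻¹) * hpp)
    (fun n => (energy_prod_le n sI hI _).trans (by
      change energy n (q sI * (q sI)⁻¹) ≤ 1
      rw [hqq, energy_one]))
    (fun n => (le_energy_prod n sO hO _).trans (by
      change energy n (p sO * (p sO)⁻¹) ≤ 1
      rw [hpp, energy_one]))
  rw [map_mul, hqO, one_mul, PowerSeries.constantCoeff_inv, norm_inv, hpO, ← hM, inv_pow,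
    mul_inv_le_iff₀ (by positivity)] at key
  exact key

end Smyth

/-! ### The house, and the Schinzel–Zassenhaus conjecture from `p = ∞`. -/

section

open NumberField Module IntermediateField

/-- Apply `1 + t ≤ exp t` at `t = log H`. -/
theorem one_add_log_div_le {C H : ℝ} {d : ℕ} (hC : 0 < C) (hd : 0 < d) (hH : 0 < H)
    (h : C ≤ H ^ d) : 1 + Real.log C / d ≤ H := by
  have hd' : (0 : ℝ) < d := by exact_mod_cast hd
  have h1 : Real.log C ≤ d * Real.log H := by
    rw [← Real.log_pow]; exact Real.log_le_log hC h
  have h2 : Real.log C / d ≤ Real.log H := by rwa [div_le_iff₀' hd']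
  linarith [Real.add_one_le_exp (Real.log H), Real.exp_log hH]

section House

variable {K : Type*} [Field K] [NumberField K] {x : K}

theorem abs_norm_le_house_pow (x : K) : |(Algebra.norm ℚ x : ℚ)| ≤ (NumberField.house x) ^ finrank ℚ K := by
  obtain ⟨σ⟩ : Nonempty (K →+* ℂ) := inferInstance
  have h := norm_norm_le_norm_mul_house_pow x σ
  have h1 : ‖σ x‖ * NumberField.house x ^ (finrank ℚ K - 1) ≤ NumberField.house x * NumberField.house x ^ (finrank ℚ K - 1) :=
    mul_le_mul_of_nonneg_right (norm_embedding_le_house x σ) (pow_nonneg (house_nonneg x) _)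
  rw [← pow_succ', Nat.sub_add_cancel finrank_pos] at h1
  refine le_trans (le_of_eq ?_) (h.trans h1)
  simp [← Rat.norm_cast_real]

theorem abs_norm_eq_one_iff (hx : IsIntegral ℤ x) (h0 : x ≠ 0) :
    |Algebra.norm ℚ x| = 1 ↔ IsAlgUnit x := by
  have h := NumberField.isUnit_iff_norm (x := (⟨x, hx⟩ : 𝓞 K))
  change _ ↔ |Algebra.norm ℚ x| = 1 at h
  rw [← h]
  constructor
  · rintro ⟨u, hu⟩
    refine ⟨h0, hx, ?_⟩
    have h1 : ((u⁻¹ : (𝓞 K)ˣ) : K) = x⁻¹ := by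
      apply eq_inv_of_mul_eq_one_left
      have h2 : ((u : 𝓞 K) : K) = x := by rw [hu]; rfl
      rw [← h2, ← map_mul, Units.inv_mul, map_one]
    rw [← h1]
    exact RingOfIntegers.isIntegral_coe _
  · intro hu
    refine IsUnit.of_mul_eq_one ⟨x⁻¹, hu.isIntegral_inv⟩ ?_
    apply RingOfIntegers.ext
    exact mul_inv_cancel₀ h0

theorem two_le_house_pow_of_not_unit (hx : IsIntegral ℤ x) (h0 : x ≠ 0) (hu : ¬ IsAlgUnit x) :
    2 ≤ NumberField.house x ^ finrank ℚ K := by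
  refine le_trans ?_ (abs_norm_le_house_pow x)
  have hint : IsIntegral ℤ (Algebra.norm ℚ x) := Algebra.isIntegral_norm ℚ hx
  obtain ⟨n, hn⟩ := IsIntegrallyClosed.isIntegral_iff.mp hint
  have hn' : (n : ℚ) = Algebra.norm ℚ x := hn
  have h1 : |n| ≠ 1 := by
    intro h
    apply hu
    rw [← abs_norm_eq_one_iff hx h0, ← hn', ← Int.cast_abs, h, Int.cast_one]
  have h2 : n ≠ 0 := by
    rintro rfl
    exact Algebra.norm_ne_zero_iff.mpr h0 (by rw [← hn', Int.cast_zero])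
  have h3 : 2 ≤ |n| := by have := abs_pos.mpr h2; omega
  rw [← hn']
  exact_mod_cast h3

theorem log_le_log_house (h0 : x ≠ 0) (σ : K →+* ℂ) : Real.log ‖σ x‖ ≤ Real.log (NumberField.house x) :=
  Real.log_le_log (norm_pos_iff.mpr (by simpa using h0)) (norm_embedding_le_house x σ)

theorem exists_embedding_eq_of_root {z : ℂ} (hz : Polynomial.aeval z (minpoly ℚ x) = 0) :
    ∃ σ : K →+* ℂ, σ x = z := by
  have h : z ∈ (minpoly ℚ x).rootSet ℂ :=
    (Polynomial.mem_rootSet_of_ne (minpoly.ne_zero (Algebra.IsIntegral.isIntegral x))).mpr hz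
  rw [← Embeddings.range_eval_eq_rootSet_minpoly] at h
  obtain ⟨σ, hσ⟩ := h
  exact ⟨σ, hσ⟩

/-- If `x⁻¹` is a conjugate of `x` then `h_∞` is at most the logarithm of the house. -/
theorem heightIn_top_le_log_house (hx : IsAlgUnit x)
    (hrec : Polynomial.aeval x⁻¹ (minpoly ℚ x) = 0) : heightIn ∞ x ≤ Real.log (NumberField.house x) := by
  rw [heightIn_top_of_unit hx]
  refine ciSup_le fun σ => abs_le'.mpr ⟨log_le_log_house hx.ne_zero σ, ?_⟩
  have hz : Polynomial.aeval (σ x⁻¹) (minpoly ℚ x) = 0 := by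
    have := Polynomial.aeval_algHom_apply σ.toRatAlgHom x⁻¹ (minpoly ℚ x)
    rw [hrec, map_zero] at this
    exact this
  obtain ⟨τ, hτ⟩ := exists_embedding_eq_of_root hz
  rw [← Real.log_inv, ← norm_inv, ← map_inv₀, ← hτ]
  exact log_le_log_house hx.ne_zero τ

theorem roots_minpoly_int (hx : IsIntegral ℤ x) {z : ℂ}
    (hz : z ∈ ((minpoly ℤ x).map (Int.castRingHom ℂ)).roots) : ‖z‖ ≤ NumberField.house x := by
  have hz' : Polynomial.aeval z (minpoly ℚ x) = 0 := by
    rw [minpoly.isIntegrallyClosed_eq_field_fractions' ℚ hx, Polynomial.aeval_map_algebraMap]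
    have := (Polynomial.mem_roots'.mp hz).2
    rwa [Polynomial.IsRoot, Polynomial.eval_map] at this
  obtain ⟨σ, rfl⟩ := exists_embedding_eq_of_root hz'
  exact norm_embedding_le_house x σ

theorem prod_max_le_house_pow (hx : IsAlgUnit x) :
    (((minpoly ℤ x).map (Int.castRingHom ℂ)).roots.map fun z => max 1 ‖z‖).prod ≤
      NumberField.house x ^ (minpoly ℤ x).natDegree := by
  have h1 := one_le_house_of_isIntegral hx.isIntegral hx.ne_zero
  set s := ((minpoly ℤ x).map (Int.castRingHom ℂ)).roots
  have hs : ∀ z ∈ s, ‖z‖ ≤ NumberField.house x := fun z hz => roots_minpoly_int hx.isIntegral hz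
  have hcard : s.card ≤ (minpoly ℤ x).natDegree :=
    (Polynomial.card_roots' _).trans Polynomial.natDegree_map_le
  have key : ∀ t : Multiset ℂ, (∀ z ∈ t, ‖z‖ ≤ NumberField.house x) →
      (t.map fun z => max 1 ‖z‖).prod ≤ NumberField.house x ^ t.card := by
    intro t
    induction t using Multiset.induction_on with
    | empty => simp
    | cons a t ih =>
      intro ht
      rw [Multiset.map_cons, Multiset.prod_cons, Multiset.card_cons, pow_succ']
      exact mul_le_mul (max_le h1 (ht a (Multiset.mem_cons_self a t)))
        (ih fun z hz => ht z (Multiset.mem_cons_of_mem hz))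
        (Multiset.prod_nonneg (by simp)) (by linarith)
  exact (key s hs).trans (pow_le_pow_right₀ h1 hcard)

/-- The house of a unit `x` that generates `K` and is not conjugate to `x⁻¹`. -/
theorem five_le_house_pow (hx : IsAlgUnit x) (hgen : (minpoly ℚ x).natDegree = finrank ℚ K)
    (hrec : Polynomial.aeval x⁻¹ (minpoly ℚ x) ≠ 0) :
    5 ≤ 4 * (NumberField.house x ^ finrank ℚ K) ^ 2 := by
  set P := minpoly ℤ x
  have hP : P.Monic := minpoly.monic hx.isIntegral
  have hQ : minpoly ℚ x = P.map (algebraMap ℤ ℚ) :=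
    minpoly.isIntegrallyClosed_eq_field_fractions' ℚ hx.isIntegral
  have hdeg : P.natDegree = finrank ℚ K := by
    rw [← hgen, hQ, hP.natDegree_map]
  -- The norm of a unit is `±1`, and in absolute value it is a power of the constant term of `P`.
  have hε : P.coeff 0 * P.coeff 0 = 1 := by
    have h := (abs_norm_eq_one_iff hx.isIntegral hx.ne_zero).mpr hx
    have hxi : IsIntegral ℚ x := Algebra.IsIntegral.isIntegral x
    have hpb := Algebra.PowerBasis.norm_gen_eq_coeff_zero_minpoly (adjoin.powerBasis hxi)
    rw [adjoin.powerBasis_gen hxi, minpoly_gen, hQ, Polynomial.coeff_map] at hpb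
    rw [Algebra.norm_eq_norm_adjoin ℚ x, hpb, abs_pow, abs_mul, abs_pow, abs_neg, abs_one, one_pow,
      one_mul, pow_eq_one_iff_of_nonneg (abs_nonneg _) finrank_pos.ne'] at h
    have h' : |P.coeff 0| = 1 := by
      rw [eq_intCast] at h
      exact_mod_cast h
    rw [← abs_mul_abs_self, h', one_mul]
  -- `x⁻¹` is a root of the reverse, so a reciprocal `P` would vanish at `x⁻¹`.
  have hne : P ≠ Polynomial.C (P.coeff 0) * P.reverse := by
    intro h
    apply hrec
    let := invertibleOfNonzero hx.ne_zero
    have h1 : Polynomial.eval₂ (algebraMap ℤ K) (⅟ x) P.reverse = 0 := by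
      rw [Polynomial.eval₂_reverse_eq_zero_iff]
      exact minpoly.aeval ℤ x
    rw [hQ, Polynomial.aeval_map_algebraMap, h, map_mul, ← invOf_eq_inv x]
    change _ * Polynomial.eval₂ (algebraMap ℤ K) (⅟ x) P.reverse = 0
    rw [h1, mul_zero]
  have h5 := five_le_of_not_reciprocal hP hε hne rfl
  have hle := prod_max_le_house_pow hx
  rw [hdeg] at hle
  have hnn : 0 ≤ (((P.map (Int.castRingHom ℂ)).roots.map fun z => max 1 ‖z‖).prod) :=
    Multiset.prod_nonneg fun a ha => by
      obtain ⟨z, -, rfl⟩ := Multiset.mem_map.mp ha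
      exact zero_le_one.trans (le_max_left _ _)
  nlinarith

end House

theorem schinzelZassenhaus_of_lpLehmerBound (h : LpLehmerBound ∞) :
    SchinzelZassenhausConjecture := by
  obtain ⟨c, hc, hb⟩ := h
  -- One constant per case: reciprocal units, nonunits, nonreciprocal units. The last is halved
  -- because the Smyth bound concerns the `2d`-th power of the house.
  refine ⟨min c (min (Real.log 2) (Real.log (5 / 4) / 2)), lt_min hc
    (lt_min (Real.log_pos one_lt_two) (half_pos (Real.log_pos (by norm_num)))), ?_⟩
  intro α hα htor
  set x := genOf (α : Qbar) with hxdef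
  have hd : 0 < deg (α : Qbar) := finrank_pos
  have hd' : (0 : ℝ) < deg (α : Qbar) := by exact_mod_cast hd
  have h0 : x ≠ 0 := by
    intro h0
    exact α.ne_zero (by simpa [hxdef] using congrArg (algebraMap ℚ⟮(α : Qbar)⟯ Qbar) h0)
  have hint : IsIntegral ℤ x :=
    (isIntegral_algHom_iff (algebraMap ℚ⟮(α : Qbar)⟯ Qbar).toIntAlgHom
      (algebraMap ℚ⟮(α : Qbar)⟯ Qbar).injective).mp hα
  have hH1 : 1 ≤ NumberField.house x := one_le_house_of_isIntegral hint h0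
  have hH : 0 < NumberField.house x := by linarith
  change 1 + _ ≤ NumberField.house x
  have hmono : ∀ c' : ℝ, min c (min (Real.log 2) (Real.log (5 / 4) / 2)) ≤ c' →
      1 + c' / (deg (α : Qbar) : ℝ) ≤ NumberField.house x →
      1 + min c (min (Real.log 2) (Real.log (5 / 4) / 2)) / (deg (α : Qbar) : ℝ) ≤
        NumberField.house x := fun c' h1 h2 => le_trans (by gcongr) h2
  by_cases hu : IsAlgUnit x
  · by_cases hrec : Polynomial.aeval x⁻¹ (minpoly ℚ x) = 0
    · refine hmono c (min_le_left _ _) ?_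
      have h1 := hb α htor
      have h2 : height ∞ α ≤ Real.log (NumberField.house x) := heightIn_top_le_log_house hu hrec
      have h3 : c / (deg (α : Qbar) : ℝ) ≤ Real.log (NumberField.house x) := by
        rw [div_le_iff₀' hd']
        exact h1.trans (mul_le_mul_of_nonneg_left h2 hd'.le)
      linarith [Real.add_one_le_exp (Real.log (NumberField.house x)), Real.exp_log hH]
    · refine hmono (Real.log (5 / 4) / 2) ((min_le_right _ _).trans (min_le_right _ _)) ?_
      have h5 := five_le_house_pow hu (by
        have hmin : minpoly ℚ x = minpoly ℚ (α : Qbar) := minpoly_gen ℚ (α : Qbar)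
        rw [hmin]
        exact (adjoin.finrank (Algebra.IsIntegral.isIntegral (α : Qbar))).symm) hrec
      have h6 : (5 / 4 : ℝ) ≤ NumberField.house x ^ (deg (α : Qbar) * 2) := by
        rw [pow_mul, deg]; linarith
      have h7 := one_add_log_div_le (by norm_num) (by omega) hH h6
      rwa [Nat.cast_mul, mul_comm, ← div_div] at h7
  · refine hmono (Real.log 2) ((min_le_right _ _).trans (min_le_left _ _)) ?_
    exact one_add_log_div_le two_pos hd hH (two_le_house_pow_of_not_unit hint h0 hu)

end

end ExtremalNorm

end

theorem theorem2 :
    (∀ p : ENNReal, 1 ≤ p → ExtremalNorm.ExtremalBound p → ExtremalNorm.LpLehmerBound p) ∧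
    (ExtremalNorm.ExtremalBound 1 → ExtremalNorm.LehmerConjecture) ∧
    (ExtremalNorm.ExtremalBound ⊤ → ExtremalNorm.SchinzelZassenhausConjecture) :=
  ⟨fun _ hp h => ExtremalNorm.lpLehmerBound_of_extremalBound hp h,
    fun h => ExtremalNorm.lehmerConjecture_of_lpLehmerBound
      (ExtremalNorm.lpLehmerBound_of_extremalBound le_rfl h),
    fun h => ExtremalNorm.schinzelZassenhaus_of_lpLehmerBound
      (ExtremalNorm.lpLehmerBound_of_extremalBound le_top h)⟩
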